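/- Let $H=(V,E)$ be a finite hypergraph with $n=|V|$ vertices and a set $E$ of $m=|E|\ge 2$ hyperedges $e\subseteq V$, and let $\kappa=\sum_{v\in V}\deg(v)=\sum_{e\in E}|e|$. **Model.** In the combining CRCW PRAM, synchronous processors share a memory; reads may be concurrent, and values written simultaneously to one cell are combined by an operation (sum or maximum) that is fixed in advance for the array containing the cell. A machine operation and the generation of a random number uniform in $[0,1]$ each take one unit of time; all random numbers are independent. Time is the number of synchronous steps, and work is the total number of processor-steps. The hypergraph is given in memory by an enumeration of its $\kappa$ incident pairs $(v,e)$, $v\in e$, and by the sizes $|e|$. **Algorithm.** All vertices and hyperedges are active at first. As long as some hyperedge is neither in the matching nor inactive, the following round is executed, every phase in parallel. (1) Every active hyperedge $e$ gets a new random weight $w(e)$. (2) The counters $P[e]$ and the pointers $T[v]$ are reset; every active vertex $v$ that lies in an active hyperedge stores in $T[v]$ the active hyperedge containing $v$ of greatest weight (found by maximum-combining writes), and increases $P[T[v]]$ by one (by sum-combining writes). (3) Every active hyperedge $e$ with $P[e]=|e|$ is put into the matching, and all its vertices are marked as newly completed. (4) All active hyperedges that contain an active newly completed vertex become inactive, and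 then so do these vertices. **Theorem.** (a) There is an absolute constant $C$ such that every round, started from any contents of the memory and with any random numbers, takes time at most $C$ and work at most $C(\kappa+n)$. (b) For every $c>0$ there is a constant $C=C(c)$ such that for every such hypergraph and every such representation of it in memory, with probability at least $1-m^{-c}$ the algorithm halts after at most $C\log m$ rounds, in total time at most $C\log m$, and with total work at most $C(\kappa+n)\log m$. -/

import Mathlib

open MeasureTheory ProbabilityTheory

/-! ## The combining CRCW PRAM

Shared memory is organised in named arrays of cells, each cell holding one real number.
Processors (PEs) are numbered `0, 1, 2, …`; reads may be concurrent, and concurrent writes to one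
cell are combined by an operation that is fixed in advance for the array the cell lies in. -/

namespace PRAM

/-- The operations by which concurrent writes are combined. -/
inductive Comb
  | sum
  | max

/-- The result of combining the values `val i` written by the PEs `i ∈ W` to one cell. -/
noncomputable def Comb.combine (op : Comb) (W : Finset ℕ) (val : ℕ → ℝ) : ℝ :=
  match op with
  | .sum => ∑ i ∈ W, val i
  | .max => if h : W.Nonempty then W.sup' h val else 0

/-- Contents of the shared memory, for arrays named by `A`. -/
abbrev Mem (A : Type) := A → ℕ → ℝ

/-- Expressions that a single PE evaluates; every node is one machine operation.
Truth values are represented by `0` (false) and any other number (true). -/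
inductive Term (A : Type)
  /-- a numeric constant -/
  | lit (k : ℕ)
  /-- the number of the PE -/
  | pid
  /-- the contents of the cell of array `a` whose index is the value of `i` -/
  | load (a : A) (i : Term A)
  | plus (x y : Term A)
  | minus (x y : Term A)
  | eq (x y : Term A)
  | lt (x y : Term A)
  | and (x y : Term A)

/-- The number of machine operations needed to evaluate an expression. -/
def Term.ops {A : Type} : Term A → ℕ
  | .lit _ => 1
  | .pid => 1
  | .load _ i => i.ops + 1
  | .plus x y => x.ops + y.ops + 1
  | .minus x y => x.ops + y.ops + 1
  | .eq x y => x.ops + y.ops + 1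
  | .lt x y => x.ops + y.ops + 1
  | .and x y => x.ops + y.ops + 1

open Classical in
/-- The value of an expression for the PE with number `p` when the memory contents are `M`. -/
noncomputable def Term.eval {A : Type} (M : Mem A) (p : ℕ) : Term A → ℝ
  | .lit k => k
  | .pid => p
  | .load a i => M a ⌊i.eval M p⌋₊
  | .plus x y => x.eval M p + y.eval M p
  | .minus x y => x.eval M p - y.eval M p
  | .eq x y => if x.eval M p = y.eval M p then 1 else 0
  | .lt x y => if x.eval M p < y.eval M p then 1 else 0
  | .and x y => if x.eval M p ≠ 0 ∧ y.eval M p ≠ 0 then 1 else 0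

/-- Programs. -/
inductive Program (A : Type)
  /-- for all PEs `p < k` in parallel: if `guard` then `a[idx] ← val` -/
  | write (k : ℕ) (guard : Term A) (a : A) (idx val : Term A)
  /-- for all PEs `p < k` in parallel: if `guard` then `a[idx] ← rnd()` -/
  | rand (k : ℕ) (guard : Term A) (a : A) (idx : Term A)
  /-- sequential composition -/
  | seq (s t : Program A)
  /-- while `cond` (evaluated by the PEs `p < k`, who all get the same answer) do `body` -/
  | loop (k : ℕ) (cond : Term A) (body : Program A)

infixr:60 " ;; " => Program.seq

open Classical in
/-- The memory after all PEs `p ∈ W` simultaneously write `val p` to `a[idx p]`. A cell to which at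
least one PE writes gets the combination of the values written to it in this step, and all
other cells keep their contents. -/
noncomputable def scatter {A : Type} (comb : A → Comb) (M : Mem A) (a : A) (W : Finset ℕ)
    (idx : ℕ → ℕ) (val : ℕ → ℝ) : Mem A :=
  fun b j =>
    if b = a ∧ ∃ p ∈ W, idx p = j then (comb a).combine {p ∈ W | idx p = j} val else M b j

open Classical in
/-- The PEs `p < k` for which `guard` holds. -/
noncomputable def enabled {A : Type} (M : Mem A) (k : ℕ) (guard : Term A) : Finset ℕ :=
  {p ∈ Finset.range k | guard.eval M p ≠ 0}

/-- The memory together with the resources used so far: `time` is the number of synchronous machine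
steps, `work` the total number of PE-steps (a PE is also charged for steps in which it is idle
because its guard failed), `iters` the number of loop iterations. -/
structure State (A : Type) where
  mem : Mem A
  time : ℕ
  work : ℕ
  iters : ℕ

/-- The state with new memory `M` after `k` PEs have been used for `t` more time steps. -/
def State.advance {A : Type} (s : State A) (M : Mem A) (k t : ℕ) : State A :=
  ⟨M, s.time + t, s.work + k * t, s.iters⟩

/-- Execution of programs: `Exec comb rnd P s s'` says that the program `P`, started in state
`s`, halts in state `s'`. Here `rnd t p` is the random number that PE `p` obtains when it asks for
one in a statement that starts at time `t`. All reads of a statement precede its writes. Drawing a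
random number and writing to memory take one step each. -/
inductive Exec {A : Type} (comb : A → Comb) (rnd : ℕ → ℕ → ℝ) :
    Program A → State A → State A → Prop
  | write (k : ℕ) (guard : Term A) (a : A) (idx val : Term A) (s : State A) :
      Exec comb rnd (.write k guard a idx val) s
        (s.advance
          (scatter comb s.mem a (enabled s.mem k guard) (fun p => ⌊idx.eval s.mem p⌋₊)
            (fun p => val.eval s.mem p))
          k (guard.ops + idx.ops + val.ops + 1))
  | rand (k : ℕ) (guard : Term A) (a : A) (idx : Term A) (s : State A) :
      Exec comb rnd (.rand k guard a idx) s
        (s.advance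
          (scatter comb s.mem a (enabled s.mem k guard) (fun p => ⌊idx.eval s.mem p⌋₊)
            (fun p => rnd s.time p))
          k (guard.ops + idx.ops + 2))
  | seq {P Q : Program A} {s s' s'' : State A} :
      Exec comb rnd P s s' → Exec comb rnd Q s' s'' → Exec comb rnd (.seq P Q) s s''
  | loop_done {k : ℕ} {cond : Term A} {body : Program A} {s : State A} :
      (∀ p < k, cond.eval s.mem p = 0) →
      Exec comb rnd (.loop k cond body) s (s.advance s.mem k cond.ops)
  | loop_step {k : ℕ} {cond : Term A} {body : Program A} {s s' s'' : State A} :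
      0 < k → (∀ p < k, cond.eval s.mem p ≠ 0) →
      Exec comb rnd body (s.advance s.mem k cond.ops) s' →
      Exec comb rnd (.loop k cond body) ⟨s'.mem, s'.time, s'.work, s'.iters + 1⟩ s'' →
      Exec comb rnd (.loop k cond body) s s''

end PRAM

/-! ## Hypergraphs and their representation in memory

A hypergraph is given by a finite type `V` of vertices and a finite set `E` of hyperedges. -/

namespace HypergraphMatching

open PRAM

/-- The degree of a vertex. -/
def degree {V : Type*} [DecidableEq V] (E : Finset (Finset V)) (v : V) : ℕ :=
  (E.filter (fun e => v ∈ e)).card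

/-- The sum of all vertex degrees. -/
def kappa {V : Type*} [Fintype V] [DecidableEq V] (E : Finset (Finset V)) : ℕ :=
  ∑ v, degree E v

/-- A numbering of the vertices, of the hyperedges, and of the incident pairs `(v, e)`, `v ∈ e`. -/
structure Layout {V : Type*} [Fintype V] [DecidableEq V] (E : Finset (Finset V)) where
  vtx : Fin (Fintype.card V) ≃ V
  edg : Fin E.card ≃ {e // e ∈ E}
  pin : Fin (kappa E) ≃ {q : V × {e // e ∈ E} // q.1 ∈ q.2.1}

/-- The arrays used by the algorithm. -/
inductive Arr
  /-- input: vertex number of an incident pair -/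
  | pinV
  /-- input: hyperedge number of an incident pair -/
  | pinE
  /-- input: size of a hyperedge -/
  | size
  /-- random weight of a hyperedge -/
  | w
  /-- greatest weight of an active hyperedge at a vertex -/
  | best
  /-- one plus the number of the heaviest active hyperedge at a vertex; `0` if there is none -/
  | T
  /-- number of vertices at which a hyperedge is the heaviest one -/
  | P
  /-- positive iff the hyperedge is in the matching -/
  | matched
  /-- positive iff the vertex is marked as newly completed -/
  | completed
  /-- positive iff the vertex is inactive -/
  | vOff
  /-- positive iff the hyperedge is inactive -/
  | eOff
  /-- cell `0`: positive iff some hyperedge is neither in the matching nor inactive -/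
  | alive

/-- Concurrent writes are added, except that `best` and `T` keep the maximum. -/
def arrComb : Arr → Comb
  | .best => .max
  | .T => .max
  | _ => .sum

/-- The initial memory: the input arrays describe the hypergraph, all other cells are `0`. -/
noncomputable def initMem {V : Type*} [Fintype V] [DecidableEq V] {E : Finset (Finset V)}
    (L : Layout E) : Mem Arr
  | .pinV, i => if h : i < kappa E then ((L.vtx.symm (L.pin ⟨i, h⟩).1.1 : ℕ) : ℝ) else 0
  | .pinE, i => if h : i < kappa E then ((L.edg.symm (L.pin ⟨i, h⟩).1.2 : ℕ) : ℝ) else 0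
  | .size, j => if h : j < E.card then (((L.edg ⟨j, h⟩).1.card : ℕ) : ℝ) else 0
  | _, _ => 0

/-- The initial state. -/
noncomputable def initState {V : Type*} [Fintype V] [DecidableEq V] {E : Finset (Finset V)}
    (L : Layout E) : State Arr :=
  ⟨initMem L, 0, 0, 0⟩

/-! ## The algorithm -/

/-- Always true. -/
def always : Term Arr := .lit 1

/-- The vertex of the incident pair of this PE. -/
def myV : Term Arr := .load .pinV .pid

/-- The hyperedge of the incident pair of this PE. -/
def myE : Term Arr := .load .pinE .pid

/-- Vertex `v` is active. -/
def vActive (v : Term Arr) : Term Arr := .eq (.load .vOff v) (.lit 0)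

/-- Hyperedge `e` is active. -/
def eActive (e : Term Arr) : Term Arr := .eq (.load .eOff e) (.lit 0)

/-- Every vertex of hyperedge `e` has selected `e`: `P[e] = |e|`. -/
def eAgreed (e : Term Arr) : Term Arr := .eq (.load .P e) (.load .size e)

/-- Vertex `v` is marked as newly completed. -/
def vCompleted (v : Term Arr) : Term Arr := .lt (.lit 0) (.load .completed v)

/-- Set the flag `alive[0]` iff some hyperedge is neither inactive nor in the matching. -/
def setAlive (m : ℕ) : Program Arr :=
  .write 1 always .alive (.lit 0) (.lit 0) ;;
  .write m (.and (eActive .pid) (.eq (.load .matched .pid) (.lit 0))) .alive (.lit 0) (.lit 1)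

/-- First phase: every active hyperedge gets a new random weight. -/
def phase1 (m : ℕ) : Program Arr :=
  .rand m (eActive .pid) .w .pid

/-- Second phase: reset `P` and `T`; every active vertex finds its heaviest active hyperedge `e`,
stores it in `T`, and increases `P[e]`. -/
def phase2 (n m κ : ℕ) : Program Arr :=
  .write m always .P .pid (.lit 0) ;;
  .write n always .T .pid (.lit 0) ;;
  .write κ (.and (vActive myV) (eActive myE)) .best myV (.load .w myE) ;;
  .write κ (.and (.and (vActive myV) (eActive myE)) (.eq (.load .w myE) (.load .best myV)))
    .T myV (.plus myE (.lit 1)) ;;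
  .write n (.and (vActive .pid) (.lt (.lit 0) (.load .T .pid)))
    .P (.minus (.load .T .pid) (.lit 1)) (.lit 1)

/-- Third phase: every active hyperedge `e` with `P[e] = |e|` is put into the matching and its
vertices are marked as newly completed. -/
def phase3 (m κ : ℕ) : Program Arr :=
  .write m (.and (eActive .pid) (eAgreed .pid)) .matched .pid (.lit 1) ;;
  .write κ (.and (eActive myE) (eAgreed myE)) .completed myV (.lit 1)

/-- Fourth phase: the active hyperedges at newly completed vertices, and these vertices, become
inactive. -/
def phase4 (n κ : ℕ) : Program Arr :=
  .write κ (.and (.and (vActive myV) (vCompleted myV)) (eActive myE)) .eOff myE (.lit 1) ;;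
  .write n (.and (vActive .pid) (vCompleted .pid)) .vOff .pid (.lit 1)

/-- One round for a hypergraph with `n` vertices, `m` hyperedges and `κ` incident pairs. -/
def round (n m κ : ℕ) : Program Arr :=
  phase1 m ;; phase2 n m κ ;; phase3 m κ ;; phase4 n κ ;; setAlive m

/-- The local-max matching algorithm: rounds are executed until every hyperedge is in the matching
or inactive. -/
def localMax (n m κ : ℕ) : Program Arr :=
  .write m always .P .pid (.lit 0) ;;
  setAlive m ;;
  .loop (n + m + κ) (.lt (.lit 0) (.load .alive (.lit 0))) (round n m κ)

/-- `U t p`, for `t, p ∈ ℕ`, are independent random numbers, uniformly distributed in `[0,1]`. -/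
def IsUniformSource {Ω : Type*} [MeasurableSpace Ω] (μ : Measure Ω) (U : ℕ → ℕ → Ω → ℝ) : Prop :=
  (∀ t p, Measurable (U t p)) ∧
  (∀ t p, μ.map (U t p) = volume.restrict (Set.Icc (0 : ℝ) 1)) ∧
  iIndepFun (fun q : ℕ × ℕ => U q.1 q.2) μ

end HypergraphMatching

/-!
The program simulates Luby's algorithm with random priorities on the conflict graph of the
hypergraph, whose nodes are the hyperedges and in which two hyperedges are adjacent if they have a
common vertex.

*Analysis of the process.* In a round every active hyperedge draws a weight; the local maxima
(`winners`) enter the matching, and everything that meets a winner becomes inactive (`survivors`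
remain). If `d` denotes the degree in the graph of the active hyperedges, then for each conflict
`{j, k}` with probability at least `1 / (d j + d k)` the weight of `j` exceeds those of all other
rivals of `j` or `k` (`inv_card_le_measure_forall_lt`). In this event `j` wins and `k` becomes
inactive with its `d k` conflicts; for fixed `k` the events are disjoint
(`conflicts_survivors_add_le`). The expected number of ordered pairs in conflict that disappear is
thus at least the sum of `d k / (d j + d k)` over all ordered pairs `(j, k)` in conflict, which is
half their number (`two_mul_lintegral_conflicts_survivors_le`). The weights of a round are
independent of the past, so the expected number of conflicts is at most `m ^ 2 / 2 ^ r` after `r`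
rounds, and by Markov's inequality all conflicts are gone after `O(log m)` rounds except with
probability `m ^ (-c)` (`two_pow_mul_measure_conflicts_ne_zero_le`, `exists_rounds`). One more round
then matches all remaining hyperedges.

*Simulation.* The loop invariant `Inv` says that the inactive flags describe a set `A` of active
hyperedges whose vertices are all active. A round of the program takes `A` to the survivors for the
weights that are drawn in it (`Inv.round`). Ties are broken by the numbers of the hyperedges because
`T` keeps the maximum, so this holds for all outcomes of the random numbers, and `P[e] = |e|`
characterizes the winners (`phase2_agreed`). An iteration takes exactly `156` time steps, so round
`i` draws its random numbers at a time that is known beforehand, and the numbers of different rounds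
are independent (`exists_exec_loop`, `two_pow_mul_measure_conflicts_le`). The work of a round is
linear in `κ + n` because `m ≤ κ + n` (`card_le_kappa_add_card`).
-/

namespace LocalMaxMatching

/-! ### The conflict graph process and its one-round analysis -/

section Dynamics

variable {J : Type*} [LinearOrder J]

open Classical in
/-- The active elements `j` that beat every active element `k` with `R j k`, where weights are
compared first and ties are broken by the order of `J`. -/
noncomputable def winners (R : J → J → Prop) (A : Finset J) (w : J → ℝ) : Finset J :=
  {j ∈ A | ∀ k ∈ A, R j k → w k < w j ∨ w k = w j ∧ k ≤ j}

open Classical in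
/-- The active elements that are not related to a winner; an element with `R j j` that wins does
not survive. -/
noncomputable def survivors (R : J → J → Prop) (A : Finset J) (w : J → ℝ) : Finset J :=
  {j ∈ A | ∀ k ∈ winners R A w, ¬ R j k}

open Classical in
/-- The active elements in conflict with `k`. -/
noncomputable def rivals (R : J → J → Prop) (A : Finset J) (k : J) : Finset J :=
  {j ∈ A | R k j ∧ j ≠ k}

theorem mem_winners {R : J → J → Prop} {A : Finset J} {w : J → ℝ} {j : J} :
    j ∈ winners R A w ↔ j ∈ A ∧ ∀ k ∈ A, R j k → w k < w j ∨ w k = w j ∧ k ≤ j := by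
  simp [winners]

theorem mem_survivors {R : J → J → Prop} {A : Finset J} {w : J → ℝ} {j : J} :
    j ∈ survivors R A w ↔ j ∈ A ∧ ∀ k ∈ winners R A w, ¬ R j k := by
  simp [survivors]

theorem mem_rivals {R : J → J → Prop} {A : Finset J} {j k : J} :
    j ∈ rivals R A k ↔ j ∈ A ∧ R k j ∧ j ≠ k := by
  simp [rivals]

/-- The number of ordered pairs of distinct active elements in conflict: twice the number of edges
of the conflict graph on `A`. -/
noncomputable def conflicts (R : J → J → Prop) (A : Finset J) : ℕ :=
  ∑ k ∈ A, (rivals R A k).card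

/-- The active elements after `r` rounds, where round `i` uses the weights `w i`. -/
noncomputable def activeAfter (R : J → J → Prop) (A : Finset J) (w : ℕ → J → ℝ) : ℕ → Finset J
  | 0 => A
  | r + 1 => survivors R (activeAfter R A w r) (w r)

theorem activeAfter_succ' (R : J → J → Prop) (A : Finset J) (w : ℕ → J → ℝ) (r : ℕ) :
    activeAfter R A w (r + 1) =
      activeAfter R (survivors R A (w 0)) (fun i => w (i + 1)) r := by
  induction r with
  | zero => rfl
  | succ r ih => rw [activeAfter, ih]; rfl

theorem activeAfter_congr (R : J → J → Prop) (A : Finset J) {w w' : ℕ → J → ℝ} {r : ℕ}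
    (h : ∀ i < r, w i = w' i) : activeAfter R A w r = activeAfter R A w' r := by
  induction r with
  | zero => rfl
  | succ r ih =>
    rw [activeAfter, activeAfter, ih fun i hi => h i (hi.trans r.lt_succ_self), h r r.lt_succ_self]

theorem survivors_subset (R : J → J → Prop) (A : Finset J) (w : J → ℝ) :
    survivors R A w ⊆ A := by
  classical exact Finset.filter_subset _ _

theorem rivals_mono (R : J → J → Prop) {A B : Finset J} (h : A ⊆ B) (k : J) :
    rivals R A k ⊆ rivals R B k := by
  classical exact Finset.filter_subset_filter _ h

/-- Element `j` eliminates its rival `k` if its weight is strictly greater than the weights of all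
rivals of `j` and of `k`. This is more than is needed for `k` to become inactive, but for fixed `k`
these events are disjoint. -/
def Eliminates (R : J → J → Prop) (A : Finset J) (w : J → ℝ) (j k : J) : Prop :=
  ∀ l ∈ rivals R A j ∪ rivals R A k, l ≠ j → w l < w j

theorem Eliminates.notMem_survivors {R : J → J → Prop} {A : Finset J}
    {w : J → ℝ} {j k : J} (hj : j ∈ rivals R A k) (h : Eliminates R A w j k) :
    k ∉ survivors R A w := by
  rw [mem_rivals] at hj
  rw [mem_survivors, not_and]
  intro _ hk
  refine hk j (mem_winners.2 ⟨hj.1, fun l hl hjl => ?_⟩) hj.2.1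
  rcases eq_or_ne l j with rfl | hne
  · exact Or.inr ⟨rfl, le_rfl⟩
  · exact Or.inl (h l (Finset.mem_union_left _ (mem_rivals.2 ⟨hl, hjl, hne⟩)) hne)

open Classical in
/-- The eliminating rivals of a fixed element are unique, and each element that is eliminated takes
all its conflicts with it. -/
theorem conflicts_survivors_add_le (R : J → J → Prop) (A : Finset J)
    (w : J → ℝ) :
    conflicts R (survivors R A w) +
      ∑ k ∈ A, ∑ j ∈ rivals R A k, (if Eliminates R A w j k then (rivals R A k).card else 0) ≤
      conflicts R A := by
  have key : ∀ k ∈ A, ∑ j ∈ rivals R A k,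
      (if Eliminates R A w j k then (rivals R A k).card else 0) ≤
      if k ∈ survivors R A w then 0 else (rivals R A k).card := by
    intro k _
    by_cases hex : ∃ j ∈ rivals R A k, Eliminates R A w j k
    · obtain ⟨j, hj, hjk⟩ := hex
      rw [if_neg (hjk.notMem_survivors hj), Finset.sum_eq_single_of_mem j hj]
      · split_ifs; simp
      · intro i hi hij
        rw [if_neg]
        intro hik
        exact lt_asymm (hjk i (Finset.mem_union_right _ hi) hij)
          (hik j (Finset.mem_union_right _ hj) hij.symm)
    · push Not at hex
      rw [Finset.sum_eq_zero fun j hj => if_neg (hex j hj)]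
      exact Nat.zero_le _
  have hsub := survivors_subset R A w
  have h1 : conflicts R (survivors R A w) ≤
      ∑ k ∈ A, if k ∈ survivors R A w then (rivals R A k).card else 0 := by
    rw [Finset.sum_ite_mem, Finset.inter_eq_right.2 hsub]
    exact Finset.sum_le_sum fun k _ => Finset.card_le_card (rivals_mono R hsub k)
  calc _ ≤ (∑ k ∈ A, if k ∈ survivors R A w then (rivals R A k).card else 0) +
        ∑ k ∈ A, if k ∈ survivors R A w then 0 else (rivals R A k).card :=
        add_le_add h1 (Finset.sum_le_sum key)
    _ = conflicts R A := by
        rw [← Finset.sum_add_distrib]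
        exact Finset.sum_congr rfl fun k _ => by split_ifs <;> simp

theorem conflicts_le (R : J → J → Prop) (A : Finset J) : conflicts R A ≤ A.card ^ 2 := by
  classical
  rw [conflicts, sq, ← smul_eq_mul]
  exact Finset.sum_le_card_nsmul _ _ _ fun k _ => Finset.card_le_card (Finset.filter_subset _ _)

theorem winners_eq_of_conflicts_eq_zero {R : J → J → Prop} {A : Finset J}
    (h : conflicts R A = 0) (w : J → ℝ) : winners R A w = A := by
  ext j
  rw [mem_winners, and_iff_left_iff_imp]
  intro hj k hk hjk
  rw [conflicts, Finset.sum_eq_zero_iff] at h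
  have hempty := Finset.card_eq_zero.1 (h j hj)
  by_cases hkj : k = j
  · exact Or.inr ⟨by rw [hkj], hkj.le⟩
  · exact absurd (hempty ▸ mem_rivals.2 ⟨hk, hjk, hkj⟩) (Finset.notMem_empty k)

end Dynamics

section OneRound

variable {J Ω : Type*} [MeasurableSpace Ω] {μ : Measure Ω} [IsProbabilityMeasure μ]
  {X : J → Ω → ℝ} {ν : Measure ℝ}

theorem measure_eq_eq_zero_of_iIndepFun [NullSingletonClass ν] (hm : ∀ j, Measurable (X j))
    (hν : ∀ j, μ.map (X j) = ν) (hX : iIndepFun X μ) {i j : J} (hij : i ≠ j) :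
    μ {ω | X i ω = X j ω} = 0 := by
  have : IsProbabilityMeasure ν := hν i ▸ Measure.isProbabilityMeasure_map (hm i).aemeasurable
  have h := (indepFun_iff_map_prod_eq_prod_map_map (hm i).aemeasurable (hm j).aemeasurable).1
    (hX.indepFun hij)
  have hd : MeasurableSet {p : ℝ × ℝ | p.1 = p.2} := measurableSet_eq_fun measurable_fst
    measurable_snd
  have : μ {ω | X i ω = X j ω} = μ.map (fun ω => (X i ω, X j ω)) {p : ℝ × ℝ | p.1 = p.2} := by
    rw [Measure.map_apply ((hm i).prodMk (hm j)) hd]; rfl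
  rw [this, h, hν, hν, Measure.measure_prod_null hd]
  refine Filter.Eventually.of_forall fun x => ?_
  have : Prod.mk x ⁻¹' {p : ℝ × ℝ | p.1 = p.2} = {x} := by ext y; simp [eq_comm]
  simp [this]

theorem measurableSet_forall_lt [Countable J] (hm : ∀ j, Measurable (X j)) (S : Finset J) (j : J) :
    MeasurableSet {ω | ∀ l ∈ S, l ≠ j → X l ω < X j ω} := by
  have : {ω | ∀ l ∈ S, l ≠ j → X l ω < X j ω} =
      ⋂ l, ⋂ (_ : l ∈ S), ⋂ (_ : l ≠ j), {ω | X l ω < X j ω} := by ext; simp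
  rw [this]
  exact .iInter fun l => .iInter fun _ => .iInter fun _ => measurableSet_lt (hm l) (hm j)

/-- By symmetry each of the elements of `S` is equally likely to have the greatest weight, and ties
have probability zero. -/
theorem inv_card_le_measure_forall_lt [Fintype J] [NullSingletonClass ν]
    (hm : ∀ j, Measurable (X j))
    (hν : ∀ j, μ.map (X j) = ν) (hX : iIndepFun X μ) {S : Finset J} {j : J} (hj : j ∈ S) :
    (S.card : ENNReal)⁻¹ ≤ μ {ω | ∀ l ∈ S, l ≠ j → X l ω < X j ω} := by
  classical
  have hsymm : ∀ i ∈ S, μ {ω | ∀ l ∈ S, l ≠ i → X l ω < X i ω} =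
      μ {ω | ∀ l ∈ S, l ≠ j → X l ω < X j ω} := by
    intro i hi
    -- Exchanging `i` and `j` does not change the joint distribution of the weights.
    have hm' : ∀ k, Measurable (X (Equiv.swap i j k)) := fun k => hm _
    have h1 := (iIndepFun_iff_map_fun_eq_pi_map fun k => (hm k).aemeasurable).1 hX
    have h2 := (iIndepFun_iff_map_fun_eq_pi_map fun k => (hm' k).aemeasurable).1
      (hX.precomp (Equiv.swap i j).injective)
    simp only [hν] at h1 h2
    have hB := measurableSet_forall_lt (X := fun (k : J) (x : J → ℝ) => x k)
      (fun k => measurable_pi_apply k) S j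
    have e1 := Measure.map_apply (μ := μ) (measurable_pi_lambda _ hm) hB
    have e2 := Measure.map_apply (μ := μ) (measurable_pi_lambda _ hm') hB
    rw [h1] at e1
    rw [h2, e1] at e2
    refine Eq.trans ?_ e2.symm
    congr 1
    ext ω
    simp only [Set.mem_ofPred_eq, Set.mem_preimage, Equiv.swap_apply_right]
    have hS : ∀ l, Equiv.swap i j l ∈ S ↔ l ∈ S := by
      intro l
      by_cases h1 : l = i
      · subst h1; simp [hi, hj]
      · by_cases h2 : l = j
        · subst h2; simp [hi, hj]
        · rw [Equiv.swap_apply_of_ne_of_ne h1 h2]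
    constructor
    · intro h l hl hlj
      refine h _ ((hS l).2 hl) fun e => hlj ?_
      rw [Equiv.swap_apply_eq_iff] at e; simpa using e
    · intro h l hl hli
      have := h (Equiv.swap i j l) ((hS l).2 hl) (fun e => hli (by
        rw [Equiv.swap_apply_eq_iff] at e; simpa using e))
      simpa using this
  have hcover : (1 : ENNReal) ≤ μ (⋃ i ∈ S, {ω | ∀ l ∈ S, l ≠ i → X l ω < X i ω}) := by
    have hae : ∀ᵐ ω ∂μ, ∀ p : J × J, p.1 ≠ p.2 → X p.1 ω ≠ X p.2 ω := by
      rw [ae_all_iff]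
      intro p
      by_cases hp : p.1 = p.2
      · simp [hp]
      · simpa [ae_iff, hp] using measure_eq_eq_zero_of_iIndepFun hm hν hX hp
    rw [← measure_univ (μ := μ)]
    refine measure_mono_ae ?_
    filter_upwards [hae] with ω hω _
    obtain ⟨i, hi, hmax⟩ := S.exists_max_image (fun i => X i ω) ⟨j, hj⟩
    exact Set.mem_iUnion₂.2 ⟨i, hi, fun l hl hli => lt_of_le_of_ne (hmax l hl) (hω (l, i) hli)⟩
  have hsum := hcover.trans (measure_biUnion_finset_le S _)
  rw [Finset.sum_congr rfl hsymm, Finset.sum_const, nsmul_eq_mul] at hsum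
  exact ENNReal.inv_le_iff_le_mul (by simp [Finset.card_ne_zero_of_mem hj]) (by simp) |>.2 hsum

end OneRound

/-! ### Expected number of conflicts -/

section Expectation

variable {J : Type*} [LinearOrder J] [Fintype J]

theorem measurableSet_survivors_eq {α : Type*} [MeasurableSpace α] (R : J → J → Prop)
    {F : α → Finset J} (hF : ∀ B, MeasurableSet {a | F a = B}) {w : α → J → ℝ}
    (hw : ∀ j, Measurable fun a => w a j) (B : Finset J) :
    MeasurableSet {a | survivors R (F a) (w a) = B} := by
  have hlt : ∀ j k, Measurable fun a => w a j < w a k := fun j k =>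
    measurableSet_setOfPred.1 (measurableSet_lt (hw j) (hw k))
  have heq : ∀ j k, Measurable fun a => w a j = w a k := fun j k =>
    measurableSet_setOfPred.1 (measurableSet_eq_fun (hw j) (hw k))
  have hwin : ∀ A j, Measurable fun a => j ∈ winners R A (w a) := by
    intro A j
    simp only [mem_winners]
    exact measurable_const.and <| .forall fun k => measurable_const.imp <| measurable_const.imp <|
      (hlt k j).or ((heq k j).and measurable_const)
  have hsur : ∀ A j, Measurable fun a => j ∈ survivors R A (w a) := by
    intro A j
    simp only [mem_survivors]
    exact measurable_const.and <| .forall fun k => (hwin A k).imp measurable_const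
  have : {a | survivors R (F a) (w a) = B} =
      ⋃ A, {a | F a = A} ∩ {a | ∀ j, j ∈ survivors R A (w a) ↔ j ∈ B} := by
    ext a; simp [Finset.ext_iff (s₂ := B)]
  rw [this]
  exact .iUnion fun A => (hF A).inter <| measurableSet_setOfPred.2 <| .forall fun j =>
    (hsur A j).iff measurable_const

theorem measurable_comp_of_measurableSet_eq {α γ : Type*} [MeasurableSpace α] [MeasurableSpace γ]
    {F : α → Finset J} (hF : ∀ B, MeasurableSet {a | F a = B}) (g : Finset J → γ) :
    Measurable fun a => g (F a) := by
  let _ : MeasurableSpace (Finset J) := ⊤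
  exact measurable_from_top.comp (measurable_to_countable' (f := F) hF)

theorem measurableSet_activeAfter_eq {α : Type*} [MeasurableSpace α] (R : J → J → Prop)
    (A : Finset J) {w : α → ℕ → J → ℝ} (hw : ∀ i j, Measurable fun a => w a i j) (r : ℕ)
    (B : Finset J) : MeasurableSet {a | activeAfter R A (w a) r = B} := by
  induction r generalizing B with
  | zero => exact .const (A = B)
  | succ r ih => exact measurableSet_survivors_eq R ih (hw r) B

variable {Ω : Type*} [MeasurableSpace Ω] {μ : Measure Ω} [IsProbabilityMeasure μ] {ν : Measure ℝ}
  [NullSingletonClass ν]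

/-- One round of independent weights removes at least half of the conflicts in expectation. A rival
`j` eliminates `k` with probability at least `1 / (d j + d k)`, where `d` counts rivals, and then
the `d k` conflicts of `k` disappear; the conflict `{j, k}` therefore accounts for an expected loss
of `d k / (d j + d k) + d j / (d j + d k) = 1` ordered pairs, half of its contribution. -/
theorem two_mul_lintegral_conflicts_survivors_le {R : J → J → Prop} (hR : ∀ i j, R i j → R j i)
    (A : Finset J) {X : J → Ω → ℝ} (hm : ∀ j, Measurable (X j)) (hν : ∀ j, μ.map (X j) = ν)
    (hX : iIndepFun X μ) :
    2 * ∫⁻ ω, (conflicts R (survivors R A fun j => X j ω) : ENNReal) ∂μ ≤ conflicts R A := by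
  classical
  set d : J → ENNReal := fun k => (rivals R A k).card with hd
  have hsymm : ∀ k ∈ A, ∀ j ∈ rivals R A k, j ∈ A ∧ k ∈ rivals R A j := by
    intro k hk j hj
    rw [mem_rivals] at hj ⊢
    exact ⟨hj.1, hk, hR _ _ hj.2.1, hj.2.2.symm⟩
  have hE : ∀ j k, MeasurableSet {ω | Eliminates R A (fun j => X j ω) j k} := fun j k =>
    measurableSet_forall_lt hm _ j
  have hprob : ∀ k ∈ A, ∀ j ∈ rivals R A k,
      (d j + d k)⁻¹ ≤ μ {ω | Eliminates R A (fun j => X j ω) j k} := by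
    intro k hk j hj
    refine le_trans ?_ (inv_card_le_measure_forall_lt hm hν hX (Finset.mem_union_right _ hj))
    rw [ENNReal.inv_le_inv]
    simp only [hd, ← Nat.cast_add]
    exact Nat.cast_le.2 (Finset.card_union_le _ _)
  have hloss : (conflicts R A : ENNReal) ≤
      2 * ∑ k ∈ A, ∑ j ∈ rivals R A k, d k * (d j + d k)⁻¹ := by
    have hswap : ∑ k ∈ A, ∑ j ∈ rivals R A k, d k * (d j + d k)⁻¹ =
        ∑ k ∈ A, ∑ j ∈ rivals R A k, d j * (d j + d k)⁻¹ := by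
      rw [Finset.sum_comm' (t' := A) (s' := fun j => rivals R A j)]
      · simp only [add_comm]
      · intro k j
        exact ⟨fun h => (hsymm k h.1 j h.2).symm, fun h => (hsymm j h.2 k h.1).symm.symm⟩
    rw [two_mul]
    nth_rw 1 [hswap]
    rw [← Finset.sum_add_distrib, conflicts, Nat.cast_sum]
    refine Finset.sum_le_sum fun k hk => ?_
    rw [← Finset.sum_add_distrib, Finset.card_eq_sum_ones, Nat.cast_sum]
    refine Finset.sum_le_sum fun j hj => ?_
    rw [← add_mul, ENNReal.mul_inv_cancel]
    · simp
    · have : d k ≠ 0 := by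
        simpa [hd] using Finset.ne_empty_of_mem hj
      simp [this]
    · simp [hd]
  have hpt : ∀ ω, (conflicts R (survivors R A fun j => X j ω) : ENNReal) +
      ∑ k ∈ A, ∑ j ∈ rivals R A k,
        d k * {ω | Eliminates R A (fun j => X j ω) j k}.indicator 1 ω ≤ conflicts R A := by
    intro ω
    have := conflicts_survivors_add_le R A fun j => X j ω
    calc _ = ((conflicts R (survivors R A fun j => X j ω) + ∑ k ∈ A, ∑ j ∈ rivals R A k,
          (if Eliminates R A (fun j => X j ω) j k then (rivals R A k).card else 0) : ℕ) :
          ENNReal) := by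
          push_cast
          simp [Set.indicator_apply, hd]
      _ ≤ _ := by exact_mod_cast this
  have hmeas : Measurable fun ω => (conflicts R (survivors R A fun j => X j ω) : ENNReal) :=
    measurable_comp_of_measurableSet_eq
      (fun B => measurableSet_survivors_eq R (F := fun _ => A) (fun B => .const (A = B)) hm B)
      fun B => (conflicts R B : ENNReal)
  have hint : ∫⁻ ω, (conflicts R (survivors R A fun j => X j ω) : ENNReal) ∂μ +
      ∑ k ∈ A, ∑ j ∈ rivals R A k, d k * (d j + d k)⁻¹ ≤ conflicts R A := by
    calc _ ≤ ∫⁻ ω, (conflicts R (survivors R A fun j => X j ω) : ENNReal) ∂μ +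
          ∑ k ∈ A, ∑ j ∈ rivals R A k, d k * μ {ω | Eliminates R A (fun j => X j ω) j k} := by
          gcongr with k hk j hj
          exact hprob k hk j hj
      _ = ∫⁻ ω, ((conflicts R (survivors R A fun j => X j ω) : ENNReal) +
          ∑ k ∈ A, ∑ j ∈ rivals R A k,
            d k * {ω | Eliminates R A (fun j => X j ω) j k}.indicator 1 ω) ∂μ := by
          rw [lintegral_add_left hmeas, lintegral_finsetSum]
          · congr 1
            refine Finset.sum_congr rfl fun k _ => ?_
            rw [lintegral_finsetSum]
            · refine Finset.sum_congr rfl fun j _ => ?_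
              rw [lintegral_const_mul _ (measurable_one.indicator (hE j k)),
                lintegral_indicator_one (hE j k)]
            · exact fun j _ => (measurable_one.indicator (hE j k)).const_mul _
          · exact fun k _ => Finset.measurable_fun_sum _ fun j _ =>
              (measurable_one.indicator (hE j k)).const_mul _
      _ ≤ ∫⁻ _, (conflicts R A : ENNReal) ∂μ := lintegral_mono hpt
      _ = conflicts R A := by simp
  have h2 := mul_le_mul_right hint 2
  rw [mul_add] at h2
  refine (ENNReal.add_le_add_iff_right (a := (conflicts R A : ENNReal)) (by simp)).1 ?_
  calc _ ≤ _ := by gcongr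
    _ ≤ _ := h2
    _ = _ := two_mul _

variable {R : J → J → Prop} {X : ℕ → J → Ω → ℝ}

/-- The expected number of conflicts halves in each round, because the weights of a round are
independent of the set of elements that are still active. -/
theorem two_mul_lintegral_conflicts_activeAfter_le (hR : ∀ i j, R i j → R j i) (A : Finset J)
    (hm : ∀ i j, Measurable (X i j)) (hν : ∀ i j, μ.map (X i j) = ν)
    (hX : iIndepFun (fun q : ℕ × J => X q.1 q.2) μ) (r : ℕ) :
    2 * ∫⁻ ω, (conflicts R (activeAfter R A (fun i j => X i j ω) (r + 1)) : ENNReal) ∂μ ≤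
      ∫⁻ ω, (conflicts R (activeAfter R A (fun i j => X i j ω) r) : ENNReal) ∂μ := by
  classical
  have hF : ∀ B, MeasurableSet {ω | activeAfter R A (fun i j => X i j ω) r = B} :=
    measurableSet_activeAfter_eq R A (w := fun ω i j => X i j ω) hm r
  have hpart : ∀ G : Finset J → Ω → ENNReal, (∀ B, Measurable (G B)) →
      ∫⁻ ω, G (activeAfter R A (fun i j => X i j ω) r) ω ∂μ =
      ∑ B, ∫⁻ ω, (if activeAfter R A (fun i j => X i j ω) r = B then 1 else 0) * G B ω ∂μ := by
    intro G hG
    rw [← lintegral_finsetSum]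
    · simp
    · exact fun B _ => (Measurable.ite (hF B) measurable_const measurable_const).mul (hG B)
  have hnew : ∀ B, Measurable fun ω =>
      (conflicts R (survivors R B fun j => X r j ω) : ENNReal) := fun B =>
    measurable_comp_of_measurableSet_eq
      (fun B' => measurableSet_survivors_eq R (F := fun _ => B) (fun B' => .const (B = B')) (hm r)
        B') fun B => (conflicts R B : ENNReal)
  have hindep : ∀ B, IndepFun
      (fun ω => (if activeAfter R A (fun i j => X i j ω) r = B then 1 else 0 : ENNReal))
      (fun ω => (conflicts R (survivors R B fun j => X r j ω) : ENNReal)) μ := by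
    intro B
    -- The left function depends on the weights of the rounds before `r` only, the right one on
    -- those of round `r`.
    let S : Finset (ℕ × J) := Finset.range r ×ˢ Finset.univ
    let T : Finset (ℕ × J) := {r} ×ˢ Finset.univ
    have hST : Disjoint S T := by
      rw [Finset.disjoint_left]
      rintro ⟨i, j⟩ h1 h2
      simp only [S, T, Finset.mem_product, Finset.mem_range, Finset.mem_singleton,
        Finset.mem_univ, and_true] at h1 h2
      omega
    have h := hX.indepFun_finset S T hST fun q => hm q.1 q.2
    let past : (S → ℝ) → ℕ → J → ℝ := fun x i j => if hq : (i, j) ∈ S then x ⟨(i, j), hq⟩ else 0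
    let φ : (S → ℝ) → ENNReal := fun x => if activeAfter R A (past x) r = B then 1 else 0
    let ψ : (T → ℝ) → ENNReal := fun x =>
      (conflicts R (survivors R B fun j => x ⟨(r, j), by simp [T]⟩) : ENNReal)
    have hφ : Measurable φ := by
      refine Measurable.ite (measurableSet_activeAfter_eq R A (w := past) ?_ r B)
        measurable_const measurable_const
      intro i j
      simp only [past]
      split_ifs
      · exact measurable_pi_apply _
      · exact measurable_const
    have hψ : Measurable ψ := measurable_comp_of_measurableSet_eq
      (fun B' => measurableSet_survivors_eq R (F := fun _ => B) (fun B' => .const (B = B'))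
        (fun j => measurable_pi_apply _) B') fun B => (conflicts R B : ENNReal)
    have h' := h.comp hφ hψ
    have e : φ ∘ (fun ω (q : S) => X q.1.1 q.1.2 ω) =
        fun ω => (if activeAfter R A (fun i j => X i j ω) r = B then 1 else 0 : ENNReal) := by
      funext ω
      simp only [φ, Function.comp]
      rw [activeAfter_congr R A (w' := fun i j => X i j ω)]
      intro i hi
      funext j
      simp [past, S, hi]
    rw [e] at h'
    exact h'
  calc _ = 2 * ∫⁻ ω, (conflicts R (survivors R (activeAfter R A (fun i j => X i j ω) r)
        fun j => X r j ω) : ENNReal) ∂μ := rfl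
    _ = ∑ B, (∫⁻ ω, (if activeAfter R A (fun i j => X i j ω) r = B then 1 else 0) ∂μ) *
        (2 * ∫⁻ ω, (conflicts R (survivors R B fun j => X r j ω) : ENNReal) ∂μ) := by
        rw [hpart (fun B ω => (conflicts R (survivors R B fun j => X r j ω) : ENNReal)) hnew,
          Finset.mul_sum]
        refine Finset.sum_congr rfl fun B _ => ?_
        rw [mul_left_comm]
        congr 1
        exact lintegral_mul_eq_lintegral_mul_lintegral_of_indepFun
          (Measurable.ite (hF B) measurable_const measurable_const) (hnew B) (hindep B)
    _ ≤ ∑ B, (∫⁻ ω, (if activeAfter R A (fun i j => X i j ω) r = B then 1 else 0) ∂μ) *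
        conflicts R B := by
        gcongr with B _
        exact two_mul_lintegral_conflicts_survivors_le hR B (hm r) (hν r)
          (hX.precomp (g := fun j => (r, j)) fun _ _ h => (Prod.mk.inj h).2)
    _ = _ := by
        rw [hpart (fun B _ => (conflicts R B : ENNReal)) fun _ => measurable_const]
        refine Finset.sum_congr rfl fun B _ => ?_
        rw [lintegral_mul_const _ (Measurable.ite (hF B) measurable_const measurable_const)]

/-- Markov's inequality for the number of conflicts after `r` rounds. -/
theorem two_pow_mul_measure_conflicts_ne_zero_le (hR : ∀ i j, R i j → R j i) (A : Finset J)
    (hm : ∀ i j, Measurable (X i j)) (hν : ∀ i j, μ.map (X i j) = ν)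
    (hX : iIndepFun (fun q : ℕ × J => X q.1 q.2) μ) (r : ℕ) :
    2 ^ r * μ {ω | conflicts R (activeAfter R A (fun i j => X i j ω) r) ≠ 0} ≤
      (A.card : ENNReal) ^ 2 := by
  have hmean : 2 ^ r * ∫⁻ ω, (conflicts R (activeAfter R A (fun i j => X i j ω) r) : ENNReal) ∂μ ≤
      conflicts R A := by
    induction r with
    | zero => simp [activeAfter]
    | succ r ih =>
      refine le_trans ?_ ih
      rw [pow_succ, mul_assoc]
      gcongr
      exact two_mul_lintegral_conflicts_activeAfter_le hR A hm hν hX r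
  have hmeas := measurable_comp_of_measurableSet_eq
    (measurableSet_activeAfter_eq R A (w := fun ω i j => X i j ω) hm r)
    fun B => (conflicts R B : ENNReal)
  have hmarkov := mul_meas_ge_le_lintegral₀ (μ := μ) hmeas.aemeasurable 1
  calc _ ≤ 2 ^ r * ∫⁻ ω, (conflicts R (activeAfter R A (fun i j => X i j ω) r) : ENNReal) ∂μ := by
        gcongr
        refine le_trans (measure_mono fun ω hω => ?_) (le_of_eq_of_le (one_mul _).symm hmarkov)
        exact_mod_cast Nat.one_le_iff_ne_zero.2 hω
    _ ≤ conflicts R A := hmean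
    _ ≤ _ := by exact_mod_cast conflicts_le R A

end Expectation

/-! ### Loop-free programs and the input arrays -/

open PRAM HypergraphMatching

section Machine

variable {A : Type}

/-- The memory after the statement `a[idx] ← val`, executed by the PEs `p < k` for which `guard`
holds. -/
noncomputable def writeMem (comb : A → Comb) (M : Mem A) (k : ℕ) (guard : Term A) (a : A)
    (idx val : Term A) : Mem A :=
  scatter comb M a (enabled M k guard) (fun p => ⌊idx.eval M p⌋₊) (fun p => val.eval M p)

/-- The final state of a program without loops; loops are skipped. -/
noncomputable def run (comb : A → Comb) (rnd : ℕ → ℕ → ℝ) : Program A → State A → State A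
  | .write k guard a idx val, s =>
    s.advance (writeMem comb s.mem k guard a idx val) k (guard.ops + idx.ops + val.ops + 1)
  | .rand k guard a idx, s =>
    s.advance (scatter comb s.mem a (enabled s.mem k guard) (fun p => ⌊idx.eval s.mem p⌋₊)
      (fun p => rnd s.time p)) k (guard.ops + idx.ops + 2)
  | .seq P Q, s => run comb rnd Q (run comb rnd P s)
  | .loop _ _ _, s => s

/-- The program contains no loop. -/
def LoopFree : Program A → Prop
  | .seq P Q => LoopFree P ∧ LoopFree Q
  | .loop _ _ _ => False
  | _ => True

theorem exec_run (comb : A → Comb) (rnd : ℕ → ℕ → ℝ) {P : Program A} (hP : LoopFree P)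
    (s : State A) : Exec comb rnd P s (run comb rnd P s) := by
  induction P generalizing s with
  | write => exact .write ..
  | rand => exact .rand ..
  | seq P Q ihP ihQ => exact .seq (ihP hP.1 s) (ihQ hP.2 _)
  | loop => exact hP.elim

theorem mem_enabled {M : Mem A} {k p : ℕ} {guard : Term A} :
    p ∈ enabled M k guard ↔ p < k ∧ guard.eval M p ≠ 0 := by
  simp [enabled]

theorem eval_and_ne_zero {M : Mem A} {p : ℕ} {x y : Term A} :
    (Term.and x y).eval M p ≠ 0 ↔ x.eval M p ≠ 0 ∧ y.eval M p ≠ 0 := by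
  simp only [Term.eval]; split_ifs <;> simp_all

theorem eval_eq_ne_zero {M : Mem A} {p : ℕ} {x y : Term A} :
    (Term.eq x y).eval M p ≠ 0 ↔ x.eval M p = y.eval M p := by
  simp only [Term.eval]; split_ifs <;> simp_all

theorem eval_lt_ne_zero {M : Mem A} {p : ℕ} {x y : Term A} :
    (Term.lt x y).eval M p ≠ 0 ↔ x.eval M p < y.eval M p := by
  simp only [Term.eval]; split_ifs <;> simp_all

theorem combine_singleton (op : Comb) (p : ℕ) (val : ℕ → ℝ) : op.combine {p} val = val p := by
  cases op <;> simp [Comb.combine]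

theorem scatter_of_ne (comb : A → Comb) (M : Mem A) {a b : A} (h : b ≠ a) (W : Finset ℕ)
    (idx : ℕ → ℕ) (val : ℕ → ℝ) : scatter comb M a W idx val b = M b := by
  funext j; simp [scatter, h]

theorem writeMem_of_ne (comb : A → Comb) (M : Mem A) {a b : A} (h : b ≠ a) (k : ℕ)
    (guard idx val : Term A) : writeMem comb M k guard a idx val b = M b :=
  scatter_of_ne comb M h ..

open Classical in
theorem scatter_id (comb : A → Comb) (M : Mem A) (a : A) (W : Finset ℕ) (idx : ℕ → ℕ)
    (hidx : ∀ p, idx p = p) (val : ℕ → ℝ) (j : ℕ) :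
    scatter comb M a W idx val a j = if j ∈ W then val j else M a j := by
  simp only [scatter, hidx, true_and, exists_eq_right]
  split_ifs with h
  · rw [show {p ∈ W | p = j} = {j} by ext; simp; grind, combine_singleton]
  · rfl

open Classical in
theorem writeMem_pid (comb : A → Comb) (M : Mem A) (k : ℕ) (guard : Term A) (a : A)
    (val : Term A) (j : ℕ) :
    writeMem comb M k guard a .pid val a j =
      if j < k ∧ guard.eval M j ≠ 0 then val.eval M j else M a j := by
  rw [writeMem, scatter_id _ _ _ _ _ (fun p => by simp [Term.eval])]
  simp only [mem_enabled]

/-- In a statement with this guard and index, PE `p` writes to cell `j`. -/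
def Writes (M : Mem A) (k : ℕ) (guard idx : Term A) (j p : ℕ) : Prop :=
  p < k ∧ guard.eval M p ≠ 0 ∧ ⌊idx.eval M p⌋₊ = j

theorem writeMem_of_forall_not (comb : A → Comb) (M : Mem A) {k : ℕ} {guard idx : Term A} (a : A)
    (val : Term A) {j : ℕ} (h : ∀ p, ¬ Writes M k guard idx j p) :
    writeMem comb M k guard a idx val a j = M a j := by
  rw [writeMem, scatter, if_neg]
  rintro ⟨-, p, hp, hpj⟩
  rw [mem_enabled] at hp
  exact h p ⟨hp.1, hp.2, hpj⟩

open Classical in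
theorem writeMem_sum_one {comb : A → Comb} (M : Mem A) (k : ℕ) (guard idx : Term A) {a : A}
    (ha : comb a = .sum) (j : ℕ) :
    writeMem comb M k guard a idx (.lit 1) a j =
      if ∃ p, Writes M k guard idx j p then
        (({p ∈ Finset.range k | Writes M k guard idx j p}.card : ℕ) : ℝ)
      else M a j := by
  split_ifs with h
  · obtain ⟨p, hk, hg, hp⟩ := h
    rw [writeMem, scatter, if_pos ⟨rfl, p, mem_enabled.2 ⟨hk, hg⟩, hp⟩, ha]
    simp only [Comb.combine, Term.eval, Nat.cast_one, Finset.sum_const, nsmul_eq_mul, mul_one]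
    congr 2
    ext q
    rw [Finset.mem_filter, Finset.mem_filter, mem_enabled, Finset.mem_range, Writes]
    tauto
  · exact writeMem_of_forall_not _ _ _ _ (not_exists.1 h)

theorem writeMem_sum_one_pos {comb : A → Comb} (M : Mem A) (k : ℕ) (guard idx : Term A) {a : A}
    (ha : comb a = .sum) (j : ℕ) (h : ∃ p, Writes M k guard idx j p) :
    0 < writeMem comb M k guard a idx (.lit 1) a j := by
  classical
  rw [writeMem_sum_one M k guard idx ha, if_pos h, Nat.cast_pos, Finset.card_pos]
  obtain ⟨p, hp⟩ := h
  exact ⟨p, by simp [hp, hp.1]⟩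

theorem isGreatest_writeMem_max {comb : A → Comb} (M : Mem A) (k : ℕ) (guard idx val : Term A)
    {a : A} (ha : comb a = .max) (j : ℕ) (h : ∃ p, Writes M k guard idx j p) :
    IsGreatest {x | ∃ p, Writes M k guard idx j p ∧ val.eval M p = x}
      (writeMem comb M k guard a idx val a j) := by
  classical
  obtain ⟨p, hk, hg, hp⟩ := h
  have hmem : ∀ q, q ∈ {q ∈ enabled M k guard | ⌊idx.eval M q⌋₊ = j} ↔
      Writes M k guard idx j q := by
    intro q; simp [mem_enabled, Writes, and_assoc]
  have hne : {q ∈ enabled M k guard | ⌊idx.eval M q⌋₊ = j}.Nonempty := ⟨p, (hmem p).2 ⟨hk, hg, hp⟩⟩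
  rw [writeMem, scatter, if_pos ⟨rfl, p, mem_enabled.2 ⟨hk, hg⟩, hp⟩, ha]
  simp only [Comb.combine]
  rw [dif_pos hne]
  constructor
  · obtain ⟨q, hq, e⟩ := Finset.exists_mem_eq_sup' hne fun p => val.eval M p
    exact ⟨q, (hmem q).1 hq, e.symm⟩
  · rintro x ⟨q, hq, rfl⟩
    exact Finset.le_sup' (fun p => val.eval M p) ((hmem q).2 hq)

end Machine

section Round

variable {V : Type*} [Fintype V] [DecidableEq V] {E : Finset (Finset V)}

/-- The vertex with number `i` lies in the hyperedge with number `j`. -/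
def Inc (L : Layout E) (i : Fin (Fintype.card V)) (j : Fin E.card) : Prop :=
  L.vtx i ∈ (L.edg j).1

/-- The hyperedges with numbers `j` and `k` have a common vertex. In particular `Meets L j j` holds
unless hyperedge `j` is empty; an empty hyperedge stays active after it has been matched. -/
def Meets (L : Layout E) (j k : Fin E.card) : Prop := ∃ i, Inc L i j ∧ Inc L i k

theorem Meets.symm (L : Layout E) (j k : Fin E.card) (h : Meets L j k) : Meets L k j :=
  h.imp fun _ hi => hi.symm

/-- The memory holds the input that is given by `L`. -/
structure HasInput (L : Layout E) (M : Mem Arr) : Prop where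
  pinV : M .pinV = initMem L .pinV
  pinE : M .pinE = initMem L .pinE
  size : M .size = initMem L .size

/-- Invariant of the main loop: `A` is the set of active hyperedges, all vertices of active
hyperedges are active, and all completed vertices are inactive. -/
structure Inv (L : Layout E) (A : Finset (Fin E.card)) (M : Mem Arr) : Prop extends
    HasInput L M where
  eOff : ∀ j : Fin E.card, M .eOff j = 0 ↔ j ∈ A
  vOff : ∀ (i : Fin (Fintype.card V)), ∀ j ∈ A, Inc L i j → M .vOff i = 0
  completed : ∀ i : Fin (Fintype.card V), 0 < M .completed i → M .vOff i ≠ 0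

theorem HasInput.of_eq {L : Layout E} {M M' : Mem Arr} (h : HasInput L M)
    (hV : M' .pinV = M .pinV) (hE : M' .pinE = M .pinE) (hs : M' .size = M .size) :
    HasInput L M' :=
  ⟨hV.trans h.pinV, hE.trans h.pinE, hs.trans h.size⟩

theorem HasInput.exists_pe {L : Layout E} {M : Mem Arr} (h : HasInput L M) {p : ℕ}
    (hp : p < kappa E) : ∃ i j, Inc L i j ∧ M .pinV p = (i : ℕ) ∧ M .pinE p = (j : ℕ) := by
  refine ⟨L.vtx.symm (L.pin ⟨p, hp⟩).1.1, L.edg.symm (L.pin ⟨p, hp⟩).1.2, ?_, ?_, ?_⟩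
  · simpa [Inc] using (L.pin ⟨p, hp⟩).2
  · rw [h.pinV]; simp [initMem, hp]
  · rw [h.pinE]; simp [initMem, hp]

theorem HasInput.exists_of_inc {L : Layout E} {M : Mem Arr} (h : HasInput L M)
    {i : Fin (Fintype.card V)} {j : Fin E.card} (hij : Inc L i j) :
    ∃ p < kappa E, M .pinV p = (i : ℕ) ∧ M .pinE p = (j : ℕ) := by
  refine ⟨L.pin.symm ⟨(L.vtx i, L.edg j), hij⟩, Fin.is_lt _, ?_, ?_⟩
  · rw [h.pinV]; simp [initMem]
  · rw [h.pinE]; simp [initMem]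

theorem HasInput.size_eq {L : Layout E} {M : Mem Arr} (h : HasInput L M) (j : Fin E.card)
    [DecidablePred fun i => Inc L i j] :
    M .size j = (({i | Inc L i j} : Finset (Fin (Fintype.card V))).card : ℕ) := by
  rw [h.size]
  simp only [initMem, j.2, dif_pos, Fin.eta]
  congr 1
  symm
  refine Finset.card_bij (fun i _ => L.vtx i) (fun i hi => (Finset.mem_filter.1 hi).2)
    (fun _ _ _ _ e => L.vtx.injective e) fun v hv => ⟨L.vtx.symm v,
      Finset.mem_filter.2 ⟨Finset.mem_univ _, by simpa [Inc] using hv⟩, by simp⟩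

theorem eval_myV (M : Mem Arr) (p : ℕ) : myV.eval M p = M .pinV p := by simp [myV, Term.eval]

theorem eval_myE (M : Mem Arr) (p : ℕ) : myE.eval M p = M .pinE p := by simp [myE, Term.eval]

theorem eval_vActive_ne_zero {M : Mem Arr} {p : ℕ} {v : Term Arr} :
    (vActive v).eval M p ≠ 0 ↔ M .vOff ⌊v.eval M p⌋₊ = 0 := by
  rw [vActive, eval_eq_ne_zero]; simp [Term.eval]

theorem eval_eActive_ne_zero {M : Mem Arr} {p : ℕ} {e : Term Arr} :
    (eActive e).eval M p ≠ 0 ↔ M .eOff ⌊e.eval M p⌋₊ = 0 := by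
  rw [eActive, eval_eq_ne_zero]; simp [Term.eval]

theorem eval_eAgreed_ne_zero {M : Mem Arr} {p : ℕ} {e : Term Arr} :
    (eAgreed e).eval M p ≠ 0 ↔ M .P ⌊e.eval M p⌋₊ = M .size ⌊e.eval M p⌋₊ := by
  rw [eAgreed, eval_eq_ne_zero]; simp [Term.eval]

theorem eval_vCompleted_ne_zero {M : Mem Arr} {p : ℕ} {v : Term Arr} :
    (vCompleted v).eval M p ≠ 0 ↔ 0 < M .completed ⌊v.eval M p⌋₊ := by
  rw [vCompleted, eval_lt_ne_zero]; simp [Term.eval]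

theorem eval_always_ne_zero {M : Mem Arr} {p : ℕ} : always.eval M p ≠ 0 := by
  simp [always, Term.eval]

end Round

/-! ### Selection of the heaviest hyperedge at a vertex -/

section Phases

variable {V : Type*} [Fintype V] [DecidableEq V] {E : Finset (Finset V)} {L : Layout E}
  {A : Finset (Fin E.card)} {M : Mem Arr}

theorem HasInput.exists_writes_myV (h : HasInput L M) {g : Term Arr} {i : Fin (Fintype.card V)}
    {F : ℕ → Prop} {Q : Fin E.card → Prop}
    (hQ : ∀ p (j : Fin E.card), Inc L i j → M .pinV p = (i : ℕ) → M .pinE p = (j : ℕ) →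
      (g.eval M p ≠ 0 ∧ F p ↔ Q j)) :
    (∃ p, Writes M (kappa E) g myV i p ∧ F p) ↔ ∃ j, Inc L i j ∧ Q j := by
  constructor
  · rintro ⟨p, ⟨hp, hg, hi'⟩, hF⟩
    obtain ⟨i', j, hij, hi, hj⟩ := h.exists_pe hp
    rw [eval_myV, hi, Nat.floor_natCast] at hi'
    obtain rfl := Fin.ext hi'
    exact ⟨j, hij, (hQ p j hij hi hj).1 ⟨hg, hF⟩⟩
  · rintro ⟨j, hij, hj⟩
    obtain ⟨p, hp, hpi, hpj⟩ := h.exists_of_inc hij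
    obtain ⟨hg, hF⟩ := (hQ p j hij hpi hpj).2 hj
    exact ⟨p, ⟨hp, hg, by rw [eval_myV, hpi, Nat.floor_natCast]⟩, hF⟩

theorem HasInput.exists_writes_myE (h : HasInput L M) {g : Term Arr} {j : Fin E.card}
    {Q : Fin (Fintype.card V) → Prop}
    (hQ : ∀ p (i : Fin (Fintype.card V)), Inc L i j → M .pinV p = (i : ℕ) → M .pinE p = (j : ℕ) →
      (g.eval M p ≠ 0 ↔ Q i)) :
    (∃ p, Writes M (kappa E) g myE j p) ↔ ∃ i, Inc L i j ∧ Q i := by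
  constructor
  · rintro ⟨p, hp, hg, hj'⟩
    obtain ⟨i, j', hij, hi, hj⟩ := h.exists_pe hp
    rw [eval_myE, hj, Nat.floor_natCast] at hj'
    obtain rfl := Fin.ext hj'
    exact ⟨i, hij, (hQ p i hij hi hj).1 hg⟩
  · rintro ⟨i, hij, hi⟩
    obtain ⟨p, hp, hpi, hpj⟩ := h.exists_of_inc hij
    exact ⟨p, hp, (hQ p i hij hpi hpj).2 hi, by rw [eval_myE, hpj, Nat.floor_natCast]⟩

theorem Inv.of_eq {M' : Mem Arr} (h : Inv L A M) (hV : M' .pinV = M .pinV)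
    (hE : M' .pinE = M .pinE) (hs : M' .size = M .size) (he : M' .eOff = M .eOff)
    (hv : M' .vOff = M .vOff) (hc : M' .completed = M .completed) : Inv L A M' where
  toHasInput := h.toHasInput.of_eq hV hE hs
  eOff := he ▸ h.eOff
  vOff := hv ▸ h.vOff
  completed := hv ▸ hc ▸ h.completed

/-- Hyperedge `j` is the one that vertex `i` selects: the heaviest active hyperedge at `i`. -/
def Selects (L : Layout E) (A : Finset (Fin E.card)) (w : Fin E.card → ℝ)
    (i : Fin (Fintype.card V)) (j : Fin E.card) : Prop :=
  Inc L i j ∧ j ∈ A ∧ ∀ k ∈ A, Inc L i k → w k < w j ∨ w k = w j ∧ k ≤ j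

theorem Selects.unique {w : Fin E.card → ℝ} {i : Fin (Fintype.card V)} {j k : Fin E.card}
    (hj : Selects L A w i j) (hk : Selects L A w i k) : j = k := by
  rcases hj.2.2 k hk.2.1 hk.1 with h | h <;> rcases hk.2.2 j hj.2.1 hj.1 with h' | h'
  · exact absurd h h'.not_gt
  · exact absurd h'.1.symm h.ne
  · exact absurd h.1.symm h'.ne
  · exact le_antisymm h'.2 h.2

theorem exists_selects {i : Fin (Fintype.card V)} (w : Fin E.card → ℝ)
    (h : ∃ j ∈ A, Inc L i j) : ∃ j, Selects L A w i j := by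
  classical
  obtain ⟨j₀, hj₀, hij₀⟩ := h
  obtain ⟨j, hj, hmax⟩ := Finset.exists_max_image ({j ∈ A | Inc L i j}) (fun j => toLex (w j, j))
    ⟨j₀, by simp [hj₀, hij₀]⟩
  rw [Finset.mem_filter] at hj
  refine ⟨j, hj.2, hj.1, fun k hk hik => ?_⟩
  have := hmax k (Finset.mem_filter.2 ⟨hk, hik⟩)
  rw [Prod.Lex.le_iff] at this
  exact this

theorem mem_winners_iff {w : Fin E.card → ℝ} {j : Fin E.card} (hj : j ∈ A) :
    j ∈ winners (Meets L) A w ↔ ∀ i, Inc L i j → Selects L A w i j := by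
  rw [mem_winners]
  constructor
  · exact fun h i hi => ⟨hi, hj, fun k hk hik => h.2 k hk ⟨i, hi, hik⟩⟩
  · exact fun h => ⟨hj, fun k hk ⟨i, hij, hik⟩ => (h i hij).2.2 k hk hik⟩

/-- Resetting `T` and the two maximum-combining writes make `T[i]` point to the selected
hyperedge. -/
theorem Inv.pointer_eq (h : Inv L A M) (i : Fin (Fintype.card V)) (hT : M .T i = 0) :
    let M₁ := writeMem arrComb M (kappa E) (.and (vActive myV) (eActive myE)) .best myV
      (.load .w myE)
    let M₂ := writeMem arrComb M₁ (kappa E) (.and (.and (vActive myV) (eActive myE))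
      (.eq (.load .w myE) (.load .best myV))) .T myV (.plus myE (.lit 1))
    ((∀ j ∈ A, ¬ Inc L i j) ∧ M₂ .T i = 0) ∨
      ∃ j, Selects L A (fun j => M .w j) i j ∧ M₂ .T i = ((j : ℕ) : ℝ) + 1 := by
  intro M₁ M₂
  have hI₁ : Inv L A M₁ := h.of_eq (writeMem_of_ne _ _ (by simp) ..)
    (writeMem_of_ne _ _ (by simp) ..) (writeMem_of_ne _ _ (by simp) ..)
    (writeMem_of_ne _ _ (by simp) ..) (writeMem_of_ne _ _ (by simp) ..)
    (writeMem_of_ne _ _ (by simp) ..)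
  have hw₁ : M₁ .w = M .w := writeMem_of_ne _ _ (by simp) ..
  have hT₁ : M₁ .T = M .T := writeMem_of_ne _ _ (by simp) ..
  by_cases hex : ∃ j ∈ A, Inc L i j
  · right
    obtain ⟨j₀, hj₀, hij₀⟩ := hex
    have hbest : IsGreatest {x | ∃ j ∈ A, Inc L i j ∧ M .w j = x} (M₁ .best i) := by
      have key : ∀ x, (∃ p, Writes M (kappa E) (.and (vActive myV) (eActive myE)) myV i p ∧
          Term.eval M p (.load .w myE) = x) ↔ ∃ j, Inc L i j ∧ j ∈ A ∧ M .w j = x := by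
        intro x
        refine h.toHasInput.exists_writes_myV fun p j hij hi hj => ?_
        simp only [eval_and_ne_zero, eval_vActive_ne_zero, eval_eActive_ne_zero]
        simp only [Term.eval, eval_myV, eval_myE, hi, hj, Nat.floor_natCast, h.eOff]
        have := h.vOff i j
        tauto
      have hg := isGreatest_writeMem_max (comb := arrComb) M (kappa E)
        (.and (vActive myV) (eActive myE)) myV (.load .w myE) (a := .best) rfl i
        (by obtain ⟨p, hp, -⟩ := (key (M .w j₀)).2 ⟨j₀, hij₀, hj₀, rfl⟩; exact ⟨p, hp⟩)
      convert hg using 1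
      ext x
      rw [Set.mem_ofPred_eq, Set.mem_ofPred_eq, key]
      simp only [and_left_comm]
    obtain ⟨j, hj⟩ := exists_selects (fun j => M .w j) ⟨j₀, hj₀, hij₀⟩
    refine ⟨j, hj, ?_⟩
    -- Among the hyperedges of greatest weight, `T` keeps the one with the greatest number.
    have hbj : M .w j = M₁ .best i := by
      refine le_antisymm (hbest.2 ⟨j, hj.2.1, hj.1, rfl⟩) ?_
      obtain ⟨k, hk, hik, e⟩ := hbest.1
      rw [← e]
      rcases hj.2.2 k hk hik with h' | h'
      · exact h'.le
      · exact h'.1.le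
    have key : ∀ x, (∃ p, Writes M₁ (kappa E) (.and (.and (vActive myV) (eActive myE))
        (.eq (.load .w myE) (.load .best myV))) myV i p ∧
        Term.eval M₁ p (.plus myE (.lit 1)) = x) ↔
          ∃ k, Inc L i k ∧ (k ∈ A ∧ M .w k = M .w j ∧ ((k : ℕ) : ℝ) + 1 = x) := by
      intro x
      refine hI₁.toHasInput.exists_writes_myV fun p k hik hi hk => ?_
      simp only [eval_and_ne_zero, eval_vActive_ne_zero, eval_eActive_ne_zero, eval_eq_ne_zero]
      simp only [Term.eval, eval_myV, eval_myE, hi, hk, Nat.floor_natCast, Nat.cast_one, hI₁.eOff,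
        hbj, hw₁]
      have := hI₁.vOff i k
      tauto
    have hg := isGreatest_writeMem_max (comb := arrComb) M₁ (kappa E)
      (.and (.and (vActive myV) (eActive myE)) (.eq (.load .w myE) (.load .best myV))) myV
      (.plus myE (.lit 1)) (a := .T) rfl i
      (by obtain ⟨p, hp, -⟩ := (key _).2 ⟨j, hj.1, hj.2.1, rfl, rfl⟩; exact ⟨p, hp⟩)
    refine hg.unique ⟨(key _).2 ⟨j, hj.1, hj.2.1, rfl, rfl⟩, fun x hx => ?_⟩
    obtain ⟨k, hik, hk, hkj, rfl⟩ := (key x).1 hx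
    rcases hj.2.2 k hk hik with h' | h'
    · exact absurd hkj h'.ne
    · have : (k : ℕ) ≤ j := h'.2
      gcongr
  · left
    push Not at hex
    refine ⟨hex, ?_⟩
    rw [← hT, ← hT₁]
    refine writeMem_of_forall_not _ _ _ _ fun p hp => ?_
    obtain ⟨j, hij, hj, -⟩ := (hI₁.toHasInput.exists_writes_myV (F := fun _ => True)
      (Q := fun j => j ∈ A ∧ M₁ .w j = M₁ .best i) fun p j hij hi hj => by
        simp only [eval_and_ne_zero, eval_vActive_ne_zero, eval_eActive_ne_zero, eval_eq_ne_zero]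
        simp only [Term.eval, eval_myV, eval_myE, hi, hj, Nat.floor_natCast, hI₁.eOff]
        have := hI₁.vOff i j
        tauto).1 ⟨p, hp, trivial⟩
    exact hex j hj hij

end Phases

/-! ### The effect of a round on the memory -/

section RoundEffect

variable {V : Type*} [Fintype V] [DecidableEq V] {E : Finset (Finset V)} {L : Layout E}
  {A : Finset (Fin E.card)} {rnd : ℕ → ℕ → ℝ} {s : State Arr}

theorem phase1_mem_of_ne {b : Arr} (hb : b ≠ .w) (m : ℕ) :
    (run arrComb rnd (phase1 m) s).mem b = s.mem b :=
  scatter_of_ne _ _ hb ..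

theorem phase1_w (h : Inv L A s.mem) {j : Fin E.card} (hj : j ∈ A) :
    (run arrComb rnd (phase1 E.card) s).mem .w j = rnd s.time j := by
  classical
  refine (scatter_id arrComb s.mem .w _ _ (fun p => by simp [Term.eval]) _ j).trans (if_pos ?_)
  rw [mem_enabled, eval_eActive_ne_zero]
  exact ⟨j.2, by simpa [Term.eval] using (h.eOff j).2 hj⟩

theorem phase2_mem_of_ne {b : Arr} (hP : b ≠ .P) (hT : b ≠ .T) (hb : b ≠ .best) (n m κ : ℕ) :
    (run arrComb rnd (phase2 n m κ) s).mem b = s.mem b := by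
  simp only [phase2, run, State.advance]
  rw [writeMem_of_ne _ _ hP, writeMem_of_ne _ _ hT, writeMem_of_ne _ _ hb, writeMem_of_ne _ _ hT,
    writeMem_of_ne _ _ hP]

open Classical in
/-- After the second phase `P[j]` counts the vertices that select hyperedge `j`. -/
theorem phase2_P (h : Inv L A s.mem) (j : Fin E.card) :
    (run arrComb rnd (phase2 (Fintype.card V) E.card (kappa E)) s).mem .P j =
      ((({i | Selects L A (fun j => s.mem .w j) i j} : Finset (Fin (Fintype.card V))).card : ℕ) :
        ℝ) := by
  simp only [phase2, run, State.advance]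
  set M₁ := writeMem arrComb s.mem E.card always .P .pid (.lit 0) with hM₁
  set M₂ := writeMem arrComb M₁ (Fintype.card V) always .T .pid (.lit 0) with hM₂
  have hI : Inv L A M₂ := by
    refine (h.of_eq (M' := M₁) ?_ ?_ ?_ ?_ ?_ ?_).of_eq ?_ ?_ ?_ ?_ ?_ ?_ <;>
      exact writeMem_of_ne _ _ (by simp) ..
  have hw : M₂ .w = s.mem .w := by
    rw [hM₂, writeMem_of_ne _ _ (by simp), hM₁, writeMem_of_ne _ _ (by simp)]
  have hT : ∀ i : Fin (Fintype.card V), M₂ .T i = 0 := by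
    intro i
    rw [hM₂, writeMem_pid, if_pos ⟨i.2, eval_always_ne_zero⟩]
    simp [Term.eval]
  have hptr := fun i => hI.pointer_eq i (hT i)
  simp only [hw] at hptr
  set M₃ := writeMem arrComb M₂ (kappa E) (.and (vActive myV) (eActive myE)) .best myV
    (.load .w myE) with hM₃
  set M₄ := writeMem arrComb M₃ (kappa E) (.and (.and (vActive myV) (eActive myE))
      (.eq (.load .w myE) (.load .best myV))) .T myV (.plus myE (.lit 1)) with hM₄
  have hvOff : M₄ .vOff = M₂ .vOff := by
    rw [hM₄, writeMem_of_ne _ _ (by simp), hM₃, writeMem_of_ne _ _ (by simp)]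
  have hP : M₄ .P j = 0 := by
    rw [hM₄, writeMem_of_ne _ _ (by simp), hM₃, writeMem_of_ne _ _ (by simp), hM₂,
      writeMem_of_ne _ _ (by simp), hM₁, writeMem_pid, if_pos ⟨j.2, eval_always_ne_zero⟩]
    simp [Term.eval]
  have hW : ∀ i : Fin (Fintype.card V), Writes M₄ (Fintype.card V)
      (.and (vActive .pid) (.lt (.lit 0) (.load .T .pid))) (.minus (.load .T .pid) (.lit 1)) j i ↔
      Selects L A (fun j => s.mem .w j) i j := by
    intro i
    simp only [Writes, i.2, true_and, eval_and_ne_zero, eval_vActive_ne_zero, eval_lt_ne_zero]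
    simp only [Term.eval, Nat.floor_natCast, hvOff, Nat.cast_zero, Nat.cast_one]
    rcases hptr i with ⟨hno, e⟩ | ⟨k, hk, e⟩
    · rw [e]
      exact ⟨fun h' => absurd h'.1.2 (lt_irrefl _), fun h' => absurd h'.1 (hno j h'.2.1)⟩
    · rw [e, add_sub_cancel_right, Nat.floor_natCast]
      constructor
      · rintro ⟨-, hkj⟩
        rwa [← Fin.ext hkj]
      · intro h'
        exact ⟨⟨hI.vOff i j h'.2.1 h'.1, by positivity⟩, by rw [hk.unique h']⟩
  rw [writeMem_sum_one _ _ _ _ rfl, hP]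
  have hcard : ({p ∈ Finset.range (Fintype.card V) | Writes M₄ (Fintype.card V)
      (.and (vActive .pid) (.lt (.lit 0) (.load .T .pid))) (.minus (.load .T .pid) (.lit 1)) j
      p}).card =
      ({i | Selects L A (fun j => s.mem .w j) i j} : Finset (Fin (Fintype.card V))).card := by
    symm
    refine Finset.card_bij (fun i _ => (i : ℕ)) ?_ (fun _ _ _ _ e => Fin.ext e) ?_
    · intro i hi
      exact Finset.mem_filter.2 ⟨Finset.mem_range.2 i.2, (hW i).2 (Finset.mem_filter.1 hi).2⟩
    · intro p hp
      have hp' := Finset.mem_filter.1 hp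
      exact ⟨⟨p, Finset.mem_range.1 hp'.1⟩,
        Finset.mem_filter.2 ⟨Finset.mem_univ _, (hW ⟨p, _⟩).1 hp'.2⟩, rfl⟩
  split_ifs with hex
  · rw [hcard]
  · rw [← hcard, Finset.filter_false_of_mem fun p _ hp => hex ⟨p, hp⟩]
    simp

/-- A hyperedge is selected by all its vertices iff it is a winner. -/
theorem phase2_agreed (h : Inv L A s.mem) {j : Fin E.card} (hj : j ∈ A) :
    (run arrComb rnd (phase2 (Fintype.card V) E.card (kappa E)) s).mem .P j =
      (run arrComb rnd (phase2 (Fintype.card V) E.card (kappa E)) s).mem .size j ↔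
      j ∈ winners (Meets L) A (fun j => s.mem .w j) := by
  classical
  rw [phase2_P h, phase2_mem_of_ne (by simp) (by simp) (by simp), h.toHasInput.size_eq,
    Nat.cast_inj, mem_winners_iff hj]
  have hsub : ({i | Selects L A (fun j => s.mem .w j) i j} : Finset (Fin (Fintype.card V))) ⊆
      ({i | Inc L i j} : Finset (Fin (Fintype.card V))) :=
    Finset.monotone_filter_right _ fun i _ hi => hi.1
  constructor
  · intro e i hi
    have := Finset.eq_of_subset_of_card_le hsub e.ge
    have hi' : i ∈ ({i | Inc L i j} : Finset (Fin (Fintype.card V))) :=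
      Finset.mem_filter.2 ⟨Finset.mem_univ i, hi⟩
    rw [← this] at hi'
    exact (Finset.mem_filter.1 hi').2
  · intro hall
    congr 1
    exact hsub.antisymm fun i hi => Finset.mem_filter.2
      ⟨Finset.mem_univ i, hall i (Finset.mem_filter.1 hi).2⟩

theorem phase3_mem_of_ne {b : Arr} (hm : b ≠ .matched) (hc : b ≠ .completed) (m κ : ℕ) :
    (run arrComb rnd (phase3 m κ) s).mem b = s.mem b := by
  simp only [phase3, run, State.advance]
  rw [writeMem_of_ne _ _ hc, writeMem_of_ne _ _ hm]

theorem phase3_matched (h : Inv L A s.mem) {j : Fin E.card} (hj : j ∈ A)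
    (hagree : s.mem .P j = s.mem .size j) :
    (run arrComb rnd (phase3 E.card (kappa E)) s).mem .matched j ≠ 0 := by
  classical
  simp only [phase3, run, State.advance]
  rw [writeMem_of_ne _ _ (by simp), writeMem_pid, if_pos]
  · simp [Term.eval]
  · rw [eval_and_ne_zero, eval_eActive_ne_zero, eval_eAgreed_ne_zero]
    simpa [Term.eval] using ⟨(h.eOff j).2 hj, hagree⟩

theorem phase3_completed (h : Inv L A s.mem) {B : Finset (Fin E.card)}
    (hB : ∀ j, j ∈ B ↔ j ∈ A ∧ s.mem .P j = s.mem .size j) (i : Fin (Fintype.card V)) :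
    0 < (run arrComb rnd (phase3 E.card (kappa E)) s).mem .completed i ↔
      0 < s.mem .completed i ∨ ∃ j ∈ B, Inc L i j := by
  simp only [phase3, run, State.advance]
  set M₁ := writeMem arrComb s.mem E.card (.and (eActive .pid) (eAgreed .pid)) .matched .pid
    (.lit 1) with hM₁
  have hne : ∀ b, b ≠ .matched → M₁ b = s.mem b := fun b hb => writeMem_of_ne _ _ hb ..
  have hin : HasInput L M₁ := h.toHasInput.of_eq (hne _ (by simp)) (hne _ (by simp))
    (hne _ (by simp))
  have hW := hin.exists_writes_myV (i := i) (F := fun _ => True) (Q := fun j => j ∈ B)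
    (g := .and (eActive myE) (eAgreed myE)) fun p j hij hi hj => by
      rw [eval_and_ne_zero, eval_eActive_ne_zero, eval_eAgreed_ne_zero, eval_myE, hj,
        Nat.floor_natCast, hne _ (by simp), hne _ (by simp), hne _ (by simp), h.eOff, hB, and_true]
  simp only [and_true] at hW
  by_cases hex : ∃ p, Writes M₁ (kappa E) (.and (eActive myE) (eAgreed myE)) myV i p
  · obtain ⟨j, hij, hj⟩ := hW.1 hex
    exact iff_of_true (writeMem_sum_one_pos _ _ _ _ rfl _ hex) (Or.inr ⟨j, hj, hij⟩)
  · rw [writeMem_of_forall_not _ _ _ _ (not_exists.1 hex), hne _ (by simp)]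
    rw [hW] at hex
    exact ⟨Or.inl, fun h' => h'.resolve_right fun ⟨j, hj, hij⟩ => hex ⟨j, hij, hj⟩⟩

theorem phase4_mem_of_ne {b : Arr} (he : b ≠ .eOff) (hv : b ≠ .vOff) (n κ : ℕ) :
    (run arrComb rnd (phase4 n κ) s).mem b = s.mem b := by
  simp only [phase4, run, State.advance]
  rw [writeMem_of_ne _ _ hv, writeMem_of_ne _ _ he]

theorem phase4_eOff (hin : HasInput L s.mem) (hA : ∀ j : Fin E.card, s.mem .eOff j = 0 ↔ j ∈ A)
    (j : Fin E.card) :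
    (run arrComb rnd (phase4 (Fintype.card V) (kappa E)) s).mem .eOff j = 0 ↔
      j ∈ A ∧ ∀ i : Fin (Fintype.card V), Inc L i j → s.mem .vOff i = 0 →
        ¬ 0 < s.mem .completed i := by
  simp only [phase4, run, State.advance]
  rw [writeMem_of_ne _ _ (by simp)]
  have hW := hin.exists_writes_myE (j := j)
    (Q := fun i => (s.mem .vOff i = 0 ∧ 0 < s.mem .completed i) ∧ j ∈ A)
    (g := .and (.and (vActive myV) (vCompleted myV)) (eActive myE)) fun p i hij hi hj => by
      rw [eval_and_ne_zero, eval_and_ne_zero, eval_eActive_ne_zero, eval_vActive_ne_zero,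
        eval_vCompleted_ne_zero, eval_myE, eval_myV, hj, hi, Nat.floor_natCast, Nat.floor_natCast,
        hA]
  by_cases hex : ∃ p, Writes s.mem (kappa E) (.and (.and (vActive myV) (vCompleted myV))
      (eActive myE)) myE j p
  · obtain ⟨i, hij, hi, -⟩ := hW.1 hex
    exact iff_of_false (writeMem_sum_one_pos _ _ _ _ rfl _ hex).ne'
      fun h' => h'.2 i hij hi.1 hi.2
  · rw [writeMem_of_forall_not _ _ _ _ (not_exists.1 hex), hA]
    rw [hW] at hex
    exact ⟨fun hj => ⟨hj, fun i hij hv hc => hex ⟨i, hij, ⟨hv, hc⟩, hj⟩⟩, And.left⟩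

theorem phase4_vOff (n κ : ℕ) (i : Fin n) :
    (run arrComb rnd (phase4 n κ) s).mem .vOff i = 0 ↔
      s.mem .vOff i = 0 ∧ ¬ 0 < s.mem .completed i := by
  classical
  simp only [phase4, run, State.advance]
  have hg : ∀ M : Mem Arr, M .vOff = s.mem .vOff → M .completed = s.mem .completed →
      ((i : ℕ) < n ∧ Term.eval M i (.and (vActive .pid) (vCompleted .pid)) ≠ 0 ↔
        s.mem .vOff i = 0 ∧ 0 < s.mem .completed i) := by
    intro M hv hc
    rw [eval_and_ne_zero, eval_vActive_ne_zero, eval_vCompleted_ne_zero, hv, hc]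
    simp [Term.eval]
  rw [writeMem_pid, writeMem_of_ne _ _ (by simp)]
  split_ifs with h
  · rw [hg _ (writeMem_of_ne _ _ (by simp) ..) (writeMem_of_ne _ _ (by simp) ..)] at h
    simp [Term.eval, h.2]
  · rw [hg _ (writeMem_of_ne _ _ (by simp) ..) (writeMem_of_ne _ _ (by simp) ..)] at h
    tauto

theorem setAlive_mem_of_ne {b : Arr} (ha : b ≠ .alive) (m : ℕ) :
    (run arrComb rnd (setAlive m) s).mem b = s.mem b := by
  simp only [setAlive, run, State.advance]
  rw [writeMem_of_ne _ _ ha, writeMem_of_ne _ _ ha]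

theorem setAlive_alive_eq_zero {m : ℕ}
    (h : ∀ j < m, s.mem .eOff j = 0 → s.mem .matched j ≠ 0) :
    (run arrComb rnd (setAlive m) s).mem .alive 0 = 0 := by
  classical
  simp only [setAlive, run, State.advance]
  rw [writeMem_of_forall_not]
  · have hk : ∀ p, Writes s.mem 1 always (.lit 0) 0 p ↔ p = 0 := by
      intro p
      simp [Writes, eval_always_ne_zero, Term.eval]
    rw [writeMem, scatter, if_pos ⟨rfl, 0, mem_enabled.2 ⟨one_pos, eval_always_ne_zero⟩,
      by simp [Term.eval]⟩]
    simp [arrComb, Comb.combine, Term.eval]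
  · rintro p ⟨hp, hg, -⟩
    rw [eval_and_ne_zero, eval_eActive_ne_zero, eval_eq_ne_zero] at hg
    simp only [Term.eval, Nat.floor_natCast, Nat.cast_zero] at hg
    rw [writeMem_of_ne _ _ (by simp), writeMem_of_ne _ _ (by simp)] at hg
    exact h p hp hg.1 hg.2

/-- A round of the program is a round of the abstract process, with the random numbers that are
drawn at the start of the round as weights. -/
theorem Inv.round (h : Inv L A s.mem) :
    Inv L (survivors (Meets L) A fun j => rnd s.time j)
      (run arrComb rnd (round (Fintype.card V) E.card (kappa E)) s).mem ∧
    (conflicts (Meets L) A = 0 →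
      (run arrComb rnd (round (Fintype.card V) E.card (kappa E)) s).mem .alive 0 = 0) := by
  classical
  simp only [HypergraphMatching.round, run]
  set s₁ := run arrComb rnd (phase1 E.card) s with hs₁
  set s₂ := run arrComb rnd (phase2 (Fintype.card V) E.card (kappa E)) s₁ with hs₂
  set s₃ := run arrComb rnd (phase3 E.card (kappa E)) s₂ with hs₃
  set s₄ := run arrComb rnd (phase4 (Fintype.card V) (kappa E)) s₃ with hs₄
  set s₅ := run arrComb rnd (setAlive E.card) s₄ with hs₅
  have e₁ : ∀ {b}, b ≠ .w → s₁.mem b = s.mem b := fun hb => phase1_mem_of_ne hb _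
  have e₂ : ∀ {b}, b ≠ .P → b ≠ .T → b ≠ .best → s₂.mem b = s₁.mem b :=
    fun h1 h2 h3 => phase2_mem_of_ne h1 h2 h3 ..
  have e₃ : ∀ {b}, b ≠ .matched → b ≠ .completed → s₃.mem b = s₂.mem b :=
    fun h1 h2 => phase3_mem_of_ne h1 h2 ..
  have e₄ : ∀ {b}, b ≠ .eOff → b ≠ .vOff → s₄.mem b = s₃.mem b :=
    fun h1 h2 => phase4_mem_of_ne h1 h2 ..
  have e₅ : ∀ {b}, b ≠ .alive → s₅.mem b = s₄.mem b := fun h1 => setAlive_mem_of_ne h1 _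
  have h₁ : Inv L A s₁.mem := h.of_eq (e₁ (by simp)) (e₁ (by simp)) (e₁ (by simp)) (e₁ (by simp))
    (e₁ (by simp)) (e₁ (by simp))
  have h₂ : Inv L A s₂.mem := by
    refine h₁.of_eq ?_ ?_ ?_ ?_ ?_ ?_ <;> exact e₂ (by simp) (by simp) (by simp)
  have hin₃ : HasInput L s₃.mem := by
    refine h₂.toHasInput.of_eq ?_ ?_ ?_ <;> exact e₃ (by simp) (by simp)
  have hwin : winners (Meets L) A (fun j => s₁.mem .w j) =
      winners (Meets L) A fun j => rnd s.time j := by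
    ext j
    simp only [mem_winners]
    refine and_congr_right fun hj => forall₂_congr fun k hk => ?_
    rw [phase1_w h hj, phase1_w h hk]
  set W := winners (Meets L) A fun j => rnd s.time j with hW
  have hB : ∀ j, j ∈ W ↔ j ∈ A ∧ s₂.mem .P j = s₂.mem .size j := by
    intro j
    constructor
    · intro hj
      have hjA := (mem_winners.1 hj).1
      exact ⟨hjA, (phase2_agreed h₁ hjA).2 (hwin ▸ hj)⟩
    · rintro ⟨hjA, e⟩
      exact hwin ▸ (phase2_agreed h₁ hjA).1 e
  have hcomp := phase3_completed (rnd := rnd) h₂ hB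
  have hv₃ : s₃.mem .vOff = s₂.mem .vOff := e₃ (by simp) (by simp)
  have heOff : ∀ j : Fin E.card, s₄.mem .eOff j = 0 ↔
      j ∈ survivors (Meets L) A fun j => rnd s.time j := by
    intro j
    have he₃ : ∀ j : Fin E.card, s₃.mem .eOff j = 0 ↔ j ∈ A := fun j => by
      rw [e₃ (by simp) (by simp), h₂.eOff]
    rw [phase4_eOff hin₃ he₃, mem_survivors, hv₃]
    refine and_congr_right fun hj => ?_
    constructor
    · rintro h' k hk ⟨i, hij, hik⟩
      exact h' i hij (h₂.vOff i j hj hij) ((hcomp i).2 (Or.inr ⟨k, hk, hik⟩))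
    · intro h' i hij hv hc
      rcases (hcomp i).1 hc with hc | ⟨k, hk, hik⟩
      · exact h₂.completed i hc hv
      · exact h' k hk ⟨i, hij, hik⟩
  have hvOff : ∀ i : Fin (Fintype.card V), s₄.mem .vOff i = 0 ↔
      s₂.mem .vOff i = 0 ∧ ¬ 0 < s₃.mem .completed i := fun i => by
    rw [← hv₃]; exact phase4_vOff _ _ i
  refine ⟨⟨?_, fun j => ?_, fun i j hj hij => ?_, fun i hi => ?_⟩, fun h0 => ?_⟩
  · refine hin₃.of_eq ?_ ?_ ?_ <;> rw [e₅ (by simp), e₄ (by simp) (by simp)]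
  · rw [e₅ (by simp), heOff]
  · rw [e₅ (by simp), hvOff]
    have hjA := survivors_subset _ _ _ hj
    refine ⟨h₂.vOff i j hjA hij, fun hc => ?_⟩
    rcases (hcomp i).1 hc with hc | ⟨k, hk, hik⟩
    -- A completed vertex is inactive or lies in a winner, which would have eliminated `j`.
    · exact h₂.completed i hc (h₂.vOff i j hjA hij)
    · exact (mem_survivors.1 hj).2 k hk ⟨i, hij, hik⟩
  · rw [e₅ (by simp), e₄ (by simp) (by simp)] at hi
    rw [e₅ (by simp), Ne, hvOff]
    exact fun h' => h'.2 hi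
  · refine setAlive_alive_eq_zero fun j hjm hj => ?_
    rw [e₄ (by simp) (by simp)]
    have hjA := survivors_subset _ _ _ ((heOff ⟨j, hjm⟩).1 hj)
    -- Without conflicts every active hyperedge wins, so none is active and unmatched afterwards.
    have hjW : (⟨j, hjm⟩ : Fin E.card) ∈ W := by
      rw [hW, winners_eq_of_conflicts_eq_zero h0]; exact hjA
    exact phase3_matched h₂ hjA ((hB _).1 hjW).2

theorem loopFree_round (n m κ : ℕ) : LoopFree (round n m κ) := by
  simp [HypergraphMatching.round, phase1, phase2, phase3, phase4, setAlive, LoopFree]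

theorem round_time (n m κ : ℕ) :
    (run arrComb rnd (round n m κ) s).time = s.time + 152 := by
  simp [HypergraphMatching.round, phase1, phase2, phase3, phase4, setAlive, run, State.advance,
    Term.ops, myV, myE, always, vActive, eActive, eAgreed, vCompleted, add_assoc]

theorem round_work (n m κ : ℕ) :
    (run arrComb rnd (round n m κ) s).work = s.work + (31 * n + 36 * m + 81 * κ + 4) := by
  simp only [HypergraphMatching.round, phase1, phase2, phase3, phase4, setAlive, run,
    State.advance, Term.ops, myV, myE, always, vActive, eActive, eAgreed, vCompleted]
  ring

theorem round_iters (n m κ : ℕ) : (run arrComb rnd (round n m κ) s).iters = s.iters := rfl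

end RoundEffect

/-! ### The main loop and the probability bound -/

section Algorithm

variable {V : Type*} [Fintype V] [DecidableEq V] {E : Finset (Finset V)}

/-- At most one hyperedge is empty, and the others have incident pairs. -/
theorem card_le_kappa_add_card (hE : 2 ≤ E.card) : E.card ≤ kappa E + Fintype.card V := by
  have hV : 1 ≤ Fintype.card V := by
    by_contra h
    have : IsEmpty V := Fintype.card_eq_zero_iff.1 (by omega)
    have := Finset.card_le_one_of_subsingleton E
    omega
  have hκ : kappa E = ∑ e ∈ E, e.card := by
    simp only [kappa, degree, Finset.card_filter]
    rw [Finset.sum_comm]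
    simp
  have h1 : (E.erase ∅).card ≤ ∑ e ∈ E.erase ∅, e.card := by
    rw [Finset.card_eq_sum_ones]
    exact Finset.sum_le_sum fun e he =>
      Finset.card_pos.2 (Finset.nonempty_iff_ne_empty.2 (Finset.ne_of_mem_erase he))
  have h2 : ∑ e ∈ E.erase ∅, e.card ≤ ∑ e ∈ E, e.card :=
    Finset.sum_le_sum_of_subset (Finset.erase_subset _ _)
  have h3 := Finset.pred_card_le_card_erase (s := E) (a := ∅)
  omega

theorem round_work_le (hE : 2 ≤ E.card) :
    31 * Fintype.card V + 36 * E.card + 81 * kappa E + 4 ≤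
      200 * (kappa E + Fintype.card V) := by
  have := card_le_kappa_add_card hE
  omega

variable {L : Layout E} {rnd : ℕ → ℕ → ℝ}

/-- The loop halts within `k + 1` rounds if the process has no conflict left after `k` rounds. Since
every iteration takes exactly `156` time steps, the times at which the random numbers are drawn do
not depend on the course of the computation. -/
theorem exists_exec_loop (hE : 2 ≤ E.card) (k : ℕ) {A : Finset (Fin E.card)} {s : State Arr}
    (h : Inv L A s.mem)
    (h0 : conflicts (Meets L)
      (activeAfter (Meets L) A (fun i j => rnd (s.time + 4 + 156 * i) j) k) = 0) :
    ∃ s', Exec arrComb rnd (.loop (Fintype.card V + E.card + kappa E)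
        (.lt (.lit 0) (.load .alive (.lit 0)))
        (round (Fintype.card V) E.card (kappa E))) s s' ∧
      s'.iters ≤ s.iters + (k + 1) ∧ s'.time ≤ s.time + 156 * (k + 1) + 4 ∧
      s'.work ≤ s.work + 210 * (kappa E + Fintype.card V) * (k + 1) +
        8 * (kappa E + Fintype.card V) := by
  have hκ := card_le_kappa_add_card hE
  set S := kappa E + Fintype.card V with hS
  set N := Fintype.card V + E.card + kappa E with hN
  have hNS : N ≤ 2 * S := by omega
  set cond : Term Arr := .lt (.lit 0) (.load .alive (.lit 0)) with hcond
  have hops : cond.ops = 4 := rfl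
  have hval : ∀ (M : Mem Arr) p, cond.eval M p ≠ 0 ↔ 0 < M .alive 0 := by
    intro M p
    rw [hcond, eval_lt_ne_zero]; simp [Term.eval]
  have hdone : ∀ s : State Arr, ¬ 0 < s.mem .alive 0 →
      Exec arrComb rnd (.loop N cond (round (Fintype.card V) E.card (kappa E))) s
        (s.advance s.mem N 4) := fun s hs =>
    .loop_done fun p _ => not_not.1 (mt (hval _ p).1 hs)
  induction k generalizing A s with
  | zero =>
    by_cases hs : 0 < s.mem .alive 0
    · let s₀ := s.advance s.mem N cond.ops
      let s₁ := run arrComb rnd (round (Fintype.card V) E.card (kappa E)) s₀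
      have ht : s₁.time = s.time + 4 + 152 := round_time ..
      have hw : s₁.work = s.work + N * 4 + _ := round_work ..
      have hi : s₁.iters = s.iters := round_iters ..
      have hwS := round_work_le hE
      have hal : s₁.mem .alive 0 = 0 := (Inv.round (s := s₀) h).2 h0
      refine ⟨_, .loop_step (by omega) (fun p _ => (hval _ p).2 hs)
        (exec_run _ _ (loopFree_round ..) s₀)
          (hdone _ (by rw [hal]; exact lt_irrefl _)), ?_, ?_, ?_⟩
      · change s₁.iters + 1 ≤ _; omega
      · change s₁.time + 4 ≤ _; omega
      · change s₁.work + N * 4 ≤ _; omega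
    · refine ⟨_, hdone s hs, ?_, ?_, ?_⟩ <;> simp only [State.advance] <;> omega
  | succ k ih =>
    by_cases hs : 0 < s.mem .alive 0
    · let s₀ := s.advance s.mem N cond.ops
      let s₁ := run arrComb rnd (round (Fintype.card V) E.card (kappa E)) s₀
      have ht : s₁.time = s.time + 4 + 152 := round_time ..
      have hw : s₁.work = s.work + N * 4 + _ := round_work ..
      have hi : s₁.iters = s.iters := round_iters ..
      have hwS := round_work_le hE
      obtain ⟨s', hx, h1, h2, h3⟩ := ih (s := ⟨s₁.mem, s₁.time, s₁.work, s₁.iters + 1⟩)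
        (Inv.round (s := s₀) h).1 (by
          have e : (fun i (j : Fin E.card) => rnd (s₁.time + 4 + 156 * i) j) =
              fun i (j : Fin E.card) => rnd (s.time + 4 + 156 * (i + 1)) j := by
            funext i j
            rw [ht]
            congr 1
            ring
          rw [activeAfter_succ'] at h0
          change conflicts _ (activeAfter _ _ (fun i (j : Fin E.card) =>
            rnd (s₁.time + 4 + 156 * i) j) k) = 0
          rw [e]
          exact h0)
      refine ⟨s', .loop_step (by omega) (fun p _ => (hval _ p).2 hs)
        (exec_run _ _ (loopFree_round ..) s₀) hx, ?_, ?_, ?_⟩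
      · simp only [hi] at h1; omega
      · simp only [ht] at h2; omega
      · simp only [hw] at h3
        have : 210 * S * (k + 1 + 1) = 210 * S * (k + 1) + 210 * S := by ring
        omega
    · refine ⟨_, hdone s hs, ?_, ?_, ?_⟩ <;> simp only [State.advance]
      · omega
      · omega
      · have := Nat.zero_le (210 * S * (k + 1 + 1))
        omega

theorem exists_exec_localMax (hE : 2 ≤ E.card) (L : Layout E) (k : ℕ)
    (h0 : conflicts (Meets L)
      (activeAfter (Meets L) Finset.univ (fun i j => rnd (24 + 156 * i) j) k) = 0) :
    ∃ s, Exec arrComb rnd (localMax (Fintype.card V) E.card (kappa E)) (initState L) s ∧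
      s.iters ≤ k + 1 ∧ s.time ≤ 180 * (k + 1) ∧
      s.work ≤ 240 * (kappa E + Fintype.card V) * (k + 1) := by
  have hκ := card_le_kappa_add_card hE
  let s₁ := run arrComb rnd (.write E.card always .P .pid (.lit 0)) (initState L)
  let s₂ := run arrComb rnd (setAlive E.card) s₁
  have ht : s₂.time = 20 := by
    simp [s₂, s₁, setAlive, run, State.advance, initState, Term.ops, always, eActive]
  have hw : s₂.work = E.card * 16 + 4 := by
    simp only [s₂, s₁, setAlive, run, State.advance, initState, Term.ops, always, eActive]
    ring
  have hi : s₂.iters = 0 := rfl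
  have hmem : ∀ b, b ≠ .alive → b ≠ .P → s₂.mem b = initMem L b := fun b h1 h2 =>
    (setAlive_mem_of_ne h1 _).trans (writeMem_of_ne _ _ h2 ..)
  have hinv : Inv L Finset.univ s₂.mem := by
    refine ⟨⟨?_, ?_, ?_⟩, fun j => ?_, fun i j _ _ => ?_, fun i hi => ?_⟩
    · exact hmem _ (by simp) (by simp)
    · exact hmem _ (by simp) (by simp)
    · exact hmem _ (by simp) (by simp)
    · rw [hmem _ (by simp) (by simp)]; simp [initMem]
    · rw [hmem _ (by simp) (by simp)]; simp [initMem]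
    · rw [hmem _ (by simp) (by simp)] at hi; simp [initMem] at hi
  obtain ⟨s, hx, h1, h2, h3⟩ := exists_exec_loop (rnd := rnd) hE k hinv (by rw [ht]; exact h0)
  refine ⟨s, .seq (exec_run _ _ (by simp [LoopFree]) _)
    (.seq (exec_run _ _ (by simp [setAlive, LoopFree]) _) hx), by omega, by omega, ?_⟩
  have : 240 * (kappa E + Fintype.card V) * (k + 1) =
    210 * (kappa E + Fintype.card V) * (k + 1) + 30 * (kappa E + Fintype.card V) * k +
      30 * (kappa E + Fintype.card V) := by ring
  omega

/-- The weights of different rounds and hyperedges are different random numbers of the source. -/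
theorem two_pow_mul_measure_conflicts_le (L : Layout E) {Ω : Type*} [MeasurableSpace Ω]
    {μ : Measure Ω} [IsProbabilityMeasure μ] {U : ℕ → ℕ → Ω → ℝ} (hU : IsUniformSource μ U)
    (k : ℕ) :
    2 ^ k * μ {ω | conflicts (Meets L) (activeAfter (Meets L) Finset.univ
      (fun i j => U (24 + 156 * i) j ω) k) ≠ 0} ≤ (E.card : ENNReal) ^ 2 := by
  have hg : Function.Injective fun q : ℕ × Fin E.card => (24 + 156 * q.1, (q.2 : ℕ)) := by
    rintro ⟨i, j⟩ ⟨i', j'⟩ h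
    simp only [Prod.mk.injEq] at h
    exact Prod.ext (by simp only; omega) (Fin.ext h.2)
  simpa using two_pow_mul_measure_conflicts_ne_zero_le (X := fun i (j : Fin E.card) =>
    U (24 + 156 * i) j) (Meets.symm L) Finset.univ (fun _ _ => hU.1 _ _) (fun _ _ => hU.2.1 _ _)
    (hU.2.2.precomp hg) k

/-- `⌈(c + 2) log₂ m⌉` rounds reduce the at most `m ^ 2` conflicts to an expected number of at most
`m ^ (-c)`. -/
theorem exists_rounds {c : ℝ} (hc : 0 < c) {m : ℕ} (hm : 2 ≤ m) :
    ∃ k : ℕ, (k : ℝ) + 1 ≤ (c + 4) / Real.log 2 * Real.log m ∧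
      ∀ p : ENNReal, 2 ^ k * p ≤ (m : ENNReal) ^ 2 → p ≤ ENNReal.ofReal ((m : ℝ) ^ (-c)) := by
  have hm0 : (0 : ℝ) < m := by positivity
  have hl2 : 0 < Real.log 2 := Real.log_pos (by norm_num)
  have hlm : Real.log 2 ≤ Real.log m := Real.log_le_log (by norm_num) (by exact_mod_cast hm)
  refine ⟨⌈(c + 2) * Real.log m / Real.log 2⌉₊, ?_, fun p hp => ?_⟩
  · have h1 := (Nat.ceil_lt_add_one
      (by positivity : 0 ≤ (c + 2) * Real.log m / Real.log 2)).le
    have h2 : 1 ≤ Real.log m / Real.log 2 := (one_le_div hl2).2 hlm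
    calc _ ≤ (c + 2) * Real.log m / Real.log 2 + 2 := by linarith
      _ ≤ (c + 2) * Real.log m / Real.log 2 + 2 * (Real.log m / Real.log 2) := by linarith
      _ = _ := by ring
  · set k := ⌈(c + 2) * Real.log m / Real.log 2⌉₊
    have hk : (m : ℝ) ^ (c + 2) ≤ 2 ^ k := by
      rw [← Real.rpow_natCast, Real.rpow_def_of_pos hm0, Real.rpow_def_of_pos two_pos,
        Real.exp_le_exp]
      have := Nat.le_ceil ((c + 2) * Real.log m / Real.log 2)
      rw [div_le_iff₀ hl2] at this
      linarith
    have hpk : p ≤ (m : ENNReal) ^ 2 / 2 ^ k := by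
      rw [ENNReal.le_div_iff_mul_le (by simp) (by simp), mul_comm]
      exact hp
    have he : (m : ENNReal) ^ 2 / 2 ^ k = ENNReal.ofReal ((m : ℝ) ^ 2 / 2 ^ k) := by
      rw [ENNReal.ofReal_div_of_pos (by positivity), ENNReal.ofReal_pow (by positivity),
        ENNReal.ofReal_pow (by positivity)]
      simp
    rw [he] at hpk
    refine hpk.trans (ENNReal.ofReal_le_ofReal ?_)
    rw [div_le_iff₀ (by positivity)]
    calc (m : ℝ) ^ 2 = (m : ℝ) ^ (-c) * (m : ℝ) ^ (c + 2) := by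
          rw [← Real.rpow_add hm0]; norm_num
      _ ≤ _ := by gcongr

end Algorithm

end LocalMaxMatching


open PRAM HypergraphMatching in
theorem mainTheorem3 :
    -- every round takes constant time and `O(κ + n)` work
    (∃ C : ℝ, ∀ (V : Type*) [Fintype V] [DecidableEq V] (E : Finset (Finset V)), 2 ≤ E.card →
      ∀ (rnd : ℕ → ℕ → ℝ) (s : State Arr),
        ∃ s' : State Arr,
          Exec arrComb rnd (round (Fintype.card V) E.card (kappa E)) s s' ∧
          (s'.time : ℝ) ≤ s.time + C ∧
          (s'.work : ℝ) ≤ s.work + C * (kappa E + Fintype.card V)) ∧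
    -- with high probability: `O(log m)` rounds, `O(log m)` time, `O((κ + n) log m)` work
    (∀ c : ℝ, 0 < c → ∃ C : ℝ,
      ∀ (V : Type*) [Fintype V] [DecidableEq V] (E : Finset (Finset V)) (L : Layout E),
        2 ≤ E.card →
        ∀ (Ω : Type*) [MeasurableSpace Ω] (μ : Measure Ω) [IsProbabilityMeasure μ]
          (U : ℕ → ℕ → Ω → ℝ), IsUniformSource μ U →
          μ {ω | ¬ ∃ s : State Arr,
              Exec arrComb (fun t p => U t p ω)
                (localMax (Fintype.card V) E.card (kappa E)) (initState L) s ∧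
              (s.iters : ℝ) ≤ C * Real.log E.card ∧
              (s.time : ℝ) ≤ C * Real.log E.card ∧
              (s.work : ℝ) ≤ C * ((kappa E + Fintype.card V) * Real.log E.card)}
            ≤ ENNReal.ofReal ((E.card : ℝ) ^ (-c))) := by
  refine ⟨⟨200, fun V _ _ E hE rnd s => ⟨_, LocalMaxMatching.exec_run _ _
    (LocalMaxMatching.loopFree_round ..) s, ?_, ?_⟩⟩, fun c hc =>
    ⟨240 * ((c + 4) / Real.log 2), fun V _ _ E L hE Ω _ μ _ U hU => ?_⟩⟩
  · rw [LocalMaxMatching.round_time]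
    push_cast
    linarith
  · rw [LocalMaxMatching.round_work]
    have := LocalMaxMatching.round_work_le hE
    exact_mod_cast Nat.add_le_add_left this _
  · obtain ⟨k, hk, hp⟩ := LocalMaxMatching.exists_rounds hc hE
    refine le_trans (measure_mono ?_)
      (hp _ (LocalMaxMatching.two_pow_mul_measure_conflicts_le L hU k))
    intro ω hω h0
    refine hω ?_
    obtain ⟨s, hs, hi, ht, hw⟩ := LocalMaxMatching.exists_exec_localMax
      (rnd := fun t p => U t p ω) hE L k h0
    have hi' : (s.iters : ℝ) ≤ k + 1 := by exact_mod_cast hi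
    have ht' : (s.time : ℝ) ≤ 180 * (k + 1) := by exact_mod_cast ht
    have hw' : (s.work : ℝ) ≤ 240 * (kappa E + Fintype.card V) * (k + 1) := by exact_mod_cast hw
    have hk0 : (0 : ℝ) ≤ k := k.cast_nonneg
    refine ⟨s, hs, by linarith, by linarith, hw'.trans ?_⟩
    calc _ ≤ 240 * ((kappa E : ℝ) + Fintype.card V) *
          ((c + 4) / Real.log 2 * Real.log E.card) := by gcongr
      _ = _ := by ring
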